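/- All CW-complexes are finite (hence compact Hausdorff); a CW-complex is a space together with its decomposition into open cells, and any map $\psi:D^k\to K$ that maps the interior of $D^k$ homeomorphically onto a $k$-cell $e^k$ and $\partial D^k$ into $K^{(k-1)}$ is called a characteristic map of $e^k$; complexes are regarded up to homeomorphisms that carry cells onto cells. A CW-complex $K$ \emph{elementary collapses} to a subcomplex $L$ (and $L$ elementary expands to $K$) if, for some $k\ge 1$, $K=L\cup e^{k-1}\cup e^{k}$ with cells $e^{k-1},e^{k}\not\subseteq L$, and there is a characteristic map $\psi:D^{k}\to K$ of $e^{k}$ which restricts on $\overline{\partial D^{k}\smallsetminus D^{k-1}}$ to a characteristic map of $e^{k-1}$ and satisfies $\psi(D^{k-1})\subseteq L^{(k-1)}$, where $D^{k-1}\subset\partial D^k$ is a closed hemisphere. $K$ \emph{collapses} to $L$ if there is a finite sequence of elementary collapses from $K$ to $L$. $K$ \emph{$m$-deforms} to $L$ if there is a finite sequence of CW-complexes $K=K_0,K_1,\dots,K_r=L$, all of dimension at most $m$, such that for each $0\le i<r$ either $K_i$ elementary collapses to $K_{i+1}$ or $K_i$ elementary expands to $K_{i+1}$. Let $n\ge 0$,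 let $K$ be a finite CW-complex of dimension at most $n$, and let $L\le K$ be a subcomplex that collapses to a point. Then $K$ $(n+1)$-deforms to $K/L$, the quotient space with the CW-structure whose cells are the cells of $K$ not in $L$ and one $0$-cell, the image of $L$. -/

import Mathlib

open Topology

universe u

/-- A finite CW complex: a Hausdorff space `X` with a finite CW structure on the whole of `X`.
The cells are parametrized by the cubes `[-1,1]ⁿ`, the unit balls of `Fin n → ℝ` (sup norm). -/
structure FiniteCW where
  X : Type u
  [top : TopologicalSpace X]
  [t2 : T2Space X]
  [cw : CWComplex (Set.univ : Set X)]
  [fin : CWComplex.Finite (Set.univ : Set X)]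

namespace FiniteCW

open Set Metric

attribute [instance] FiniteCW.top FiniteCW.t2 FiniteCW.cw FiniteCW.fin

/-- The `n`-cells of `K`. -/
abbrev Cell (K : FiniteCW.{u}) (n : ℕ) : Type u := RelCWComplex.cell (univ : Set K.X) n

/-- The open cell `e ⊆ K` with index `i`. -/
abbrev openCell (K : FiniteCW.{u}) (n : ℕ) (i : K.Cell n) : Set K.X :=
  RelCWComplex.openCell (C := (univ : Set K.X)) n i

/-- Subcomplexes of `K`: closed subsets that are unions of open cells of `K`. -/
abbrev Sub (K : FiniteCW.{u}) : Type u := RelCWComplex.Subcomplex (univ : Set K.X)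

/-- `dim K ≤ n`: there are no cells of dimension bigger than `n`. -/
def DimLE (K : FiniteCW.{u}) (n : ℕ) : Prop := ∀ m, n < m → IsEmpty (K.Cell m)

/-- `ψ`, restricted to the closed cube, is *a* characteristic map for the `n`-cell `i` of `K`:
it is continuous on the closed cube, maps the open cube homeomorphically onto the open cell, and
maps the boundary of the cube into the `(n-1)`-skeleton. -/
structure IsCharMap (K : FiniteCW.{u}) (n : ℕ) (i : K.Cell n) (ψ : (Fin n → ℝ) → K.X) :
    Prop where
  continuousOn : ContinuousOn ψ (closedBall 0 1)
  isEmbedding : IsEmbedding ((ball (0 : Fin n → ℝ) 1).domRestrict ψ)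
  image_ball : ψ '' ball 0 1 = K.openCell n i
  mapsTo_sphere : MapsTo ψ (sphere 0 1) (RelCWComplex.skeletonLT (univ : Set K.X) n : Set K.X)

/-- The elementary collapse of the subcomplex `E` of `K` to the subcomplex `F`, with `n = m + 1`:
`E = F ∪ eⁿ⁻¹ ∪ eⁿ` with both cells outside `F`, and some characteristic map `ψ` of `eⁿ` restricts
on one face `{x | x_n = 1}` of the cube to a characteristic map of `eⁿ⁻¹`, and maps the rest of
the boundary (the closure of the complement of that face) into the `(n-1)`-skeleton of `F`. -/
def ElemCollapse {K : FiniteCW.{u}} (E F : K.Sub) : Prop :=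
  ∃ (m : ℕ) (a : K.Cell m) (b : K.Cell (m + 1)),
    a ∉ F.I m ∧ b ∉ F.I (m + 1) ∧
    (E : Set K.X) = (F : Set K.X) ∪ K.openCell m a ∪ K.openCell (m + 1) b ∧
    ∃ ψ : (Fin (m + 1) → ℝ) → K.X,
      K.IsCharMap (m + 1) b ψ ∧
      K.IsCharMap m a (fun y => ψ (Fin.snoc (α := fun _ => ℝ) y 1)) ∧
      MapsTo ψ (closure (sphere 0 1 \ {x | x (Fin.last m) = 1}))
        (RelCWComplex.skeleton (F : Set K.X) m : Set K.X)

/-- `E` collapses to `F`: a finite sequence of elementary collapses leads from `E` to `F`. -/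
def Collapses {K : FiniteCW.{u}} (E F : K.Sub) : Prop :=
  Relation.ReflTransGen ElemCollapse E F

/-- `L` collapses to a point. -/
def CollapsesToPoint {K : FiniteCW.{u}} (L : K.Sub) : Prop :=
  ∃ (P : K.Sub) (x : K.X), (P : Set K.X) = {x} ∧ Collapses L P

/-- `K` as a subcomplex of itself. -/
def whole (K : FiniteCW.{u}) : K.Sub where
  carrier := univ
  I := fun _ => univ
  closed' := isClosed_univ
  union' := by
    refine Eq.trans ?_ (RelCWComplex.union_iUnion_openCell_eq_complex (C := (univ : Set K.X)))
    simp

/-- The complex `L` is, up to an isomorphism of CW complexes, the subcomplex `F` of `K`: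
some homeomorphism of `L` onto `F` maps the `n`-cells of `L` onto `n`-cells of `K`. -/
def IsoSub (L : FiniteCW.{u}) {K : FiniteCW.{u}} (F : K.Sub) : Prop :=
  ∃ f : L.X → K.X, IsEmbedding f ∧ range f = (F : Set K.X) ∧
    ∀ (n : ℕ) (i : L.Cell n), ∃ j : K.Cell n, f '' L.openCell n i = K.openCell n j

/-- `K` elementary collapses to the complex `L` (equivalently, `L` elementary expands to `K`). -/
def ElemCollapsesTo (K L : FiniteCW.{u}) : Prop :=
  ∃ F : K.Sub, ElemCollapse K.whole F ∧ L.IsoSub F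

/-- `K` `n`-deforms to `L`: there are complexes `K = F 0, F 1, …, F r = L` of dimension at most
`n`, each obtained from the preceding one by an elementary collapse or an elementary expansion. -/
def Deforms (n : ℕ) (K L : FiniteCW.{u}) : Prop :=
  ∃ (r : ℕ) (F : ℕ → FiniteCW.{u}), F 0 = K ∧ F r = L ∧
    (∀ i < r, (F i).ElemCollapsesTo (F (i + 1)) ∨ (F (i + 1)).ElemCollapsesTo (F i)) ∧
    ∀ i ≤ r, (F i).DimLE n

/-! ### The quotient complex `K/L` -/

/-- The equivalence relation on `K` that identifies all points of `L`. -/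
def quotSetoid (K : FiniteCW.{u}) (L : K.Sub) : Setoid K.X where
  r x y := x = y ∨ (x ∈ (L : Set K.X) ∧ y ∈ (L : Set K.X))
  iseqv :=
    { refl := fun _ => Or.inl rfl
      symm := by
        rintro x y (h | h)
        · exact Or.inl h.symm
        · exact Or.inr h.symm
      trans := by
        rintro x y z (rfl | h) (rfl | h')
        · exact Or.inl rfl
        · exact Or.inr h'
        · exact Or.inr h
        · exact Or.inr ⟨h.1, h'.2⟩ }

/-- The quotient space `K/L`. It carries the quotient topology. -/
def QuotX (K : FiniteCW.{u}) (L : K.Sub) : Type u := Quotient (K.quotSetoid L)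

variable (K : FiniteCW.{u}) (L : K.Sub)

instance : TopologicalSpace (K.QuotX L) :=
  inferInstanceAs (TopologicalSpace (Quotient (K.quotSetoid L)))

/-- The quotient map `K → K/L`. -/
def quotMk : K.X → K.QuotX L := Quotient.mk (K.quotSetoid L)

/-- Some section of the quotient map. -/
noncomputable def quotOut : K.QuotX L → K.X := Quotient.out

lemma quotMk_out (q : K.QuotX L) : K.quotMk L (K.quotOut L q) = q := Quotient.out_eq q

lemma continuous_quotMk : Continuous (K.quotMk L) := continuous_quotient_mk'

lemma isQuotientMap_quotMk : IsQuotientMap (K.quotMk L) := isQuotientMap_quotient_mk'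

variable {K L}

lemma quotMk_eq_iff {x y : K.X} : K.quotMk L x = K.quotMk L y ↔
    x = y ∨ (x ∈ (L : Set K.X) ∧ y ∈ (L : Set K.X)) := Quotient.eq (r := K.quotSetoid L)

lemma quotOut_mk {x : K.X} (hx : x ∉ (L : Set K.X)) : K.quotOut L (K.quotMk L x) = x := by
  rcases quotMk_eq_iff.1 (K.quotMk_out L (K.quotMk L x)) with h | h
  · exact h
  · exact absurd h.2 hx

lemma isOpen_image_of_disjoint {U : Set K.X} (hU : IsOpen U) (h : ∀ x ∈ U, x ∉ (L : Set K.X)) :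
    IsOpen (K.quotMk L '' U) := by
  rw [← (K.isQuotientMap_quotMk L).isOpen_preimage]
  convert hU using 1
  ext x
  constructor
  · rintro ⟨y, hy, hxy⟩
    rcases quotMk_eq_iff.1 hxy with rfl | h'
    · exact hy
    · exact absurd h'.1 (h y hy)
  · exact fun hx => ⟨x, hx, rfl⟩

lemma isOpen_image_of_subset {U : Set K.X} (hU : IsOpen U) (h : (L : Set K.X) ⊆ U) :
    IsOpen (K.quotMk L '' U) := by
  rw [← (K.isQuotientMap_quotMk L).isOpen_preimage]
  convert hU using 1
  ext x
  constructor
  · rintro ⟨y, hy, hxy⟩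
    rcases quotMk_eq_iff.1 hxy with rfl | h'
    · exact hy
    · exact h h'.2
  · exact fun hx => ⟨x, hx, rfl⟩

instance compactSpace (K : FiniteCW.{u}) : CompactSpace K.X := by
  have hfin := RelCWComplex.finite_cells_of_finite (C := (univ : Set K.X))
  have h : (⋃ p : (Σ n, K.Cell n),
      RelCWComplex.closedCell (C := (univ : Set K.X)) p.1 p.2) = univ := by
    refine Eq.trans ?_ (CWComplex.union (C := (univ : Set K.X)))
    rw [iUnion_sigma]
  constructor
  rw [← h]
  exact isCompact_iUnion fun p => RelCWComplex.isCompact_closedCell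

lemma sub_closed (L : K.Sub) : IsClosed (L : Set K.X) := L.closed'

lemma separated_of_mem {x y : K.X} (hx : x ∉ (L : Set K.X)) (hy : y ∈ (L : Set K.X)) :
    ∃ U V : Set (K.QuotX L), IsOpen U ∧ IsOpen V ∧ K.quotMk L x ∈ U ∧ K.quotMk L y ∈ V ∧
      Disjoint U V := by
  obtain ⟨U, V, hU, hV, hxU, hLV, hd⟩ :=
    SeparatedNhds.of_isCompact_isCompact (isCompact_singleton (x := x))
      (sub_closed L).isCompact (by simpa using hx)
  have hUL : ∀ z ∈ U, z ∉ (L : Set K.X) := fun z hz hzL => disjoint_left.1 hd hz (hLV hzL)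
  refine ⟨_, _, isOpen_image_of_disjoint hU hUL, isOpen_image_of_subset hV hLV,
    ⟨x, hxU rfl, rfl⟩, ⟨y, hLV hy, rfl⟩, ?_⟩
  rw [disjoint_left]
  rintro _ ⟨a, ha, rfl⟩ ⟨b, hb, hab⟩
  rcases quotMk_eq_iff.1 hab with rfl | h
  · exact disjoint_left.1 hd ha hb
  · exact hUL a ha h.2

instance quotT2 (K : FiniteCW.{u}) (L : K.Sub) : T2Space (K.QuotX L) := by
  constructor
  intro p q hpq
  obtain ⟨x, rfl⟩ := (K.isQuotientMap_quotMk L).surjective p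
  obtain ⟨y, rfl⟩ := (K.isQuotientMap_quotMk L).surjective q
  by_cases hx : x ∈ (L : Set K.X) <;> by_cases hy : y ∈ (L : Set K.X)
  · exact absurd (quotMk_eq_iff.2 (Or.inr ⟨hx, hy⟩)) hpq
  · obtain ⟨U, V, hU, hV, h1, h2, hd⟩ := separated_of_mem hy hx
    exact ⟨V, U, hV, hU, h2, h1, hd.symm⟩
  · exact separated_of_mem hx hy
  · have hxy : x ≠ y := fun h => hpq (by rw [h])
    obtain ⟨U, V, hU, hV, hxU, hyV, hd⟩ := t2_separation hxy
    have ho := (sub_closed L).isOpen_compl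
    refine ⟨_, _, isOpen_image_of_disjoint (hU.inter ho) fun z hz => hz.2,
      isOpen_image_of_disjoint (hV.inter ho) fun z hz => hz.2,
      ⟨x, ⟨hxU, hx⟩, rfl⟩, ⟨y, ⟨hyV, hy⟩, rfl⟩, ?_⟩
    rw [disjoint_left]
    rintro _ ⟨a, ha, rfl⟩ ⟨b, hb, hab⟩
    rcases quotMk_eq_iff.1 hab with rfl | h
    · exact disjoint_left.1 hd ha.1 hb.1
    · exact ha.2 h.2

lemma continuousOn_quotOut :
    ContinuousOn (K.quotOut L) (K.quotMk L '' (L : Set K.X)ᶜ) := by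
  have ho := (sub_closed L).isOpen_compl
  rw [_root_.continuousOn_iff']
  intro V hV
  refine ⟨_, isOpen_image_of_disjoint (L := L) (hV.inter ho) fun z hz => hz.2, ?_⟩
  ext q
  constructor
  · rintro ⟨h1, x, hx, rfl⟩
    rw [mem_preimage, quotOut_mk hx] at h1
    exact ⟨⟨x, ⟨h1, hx⟩, rfl⟩, x, hx, rfl⟩
  · rintro ⟨⟨x, ⟨h1, hx⟩, rfl⟩, -⟩
    refine ⟨?_, x, hx, rfl⟩
    rw [mem_preimage, quotOut_mk hx]
    exact h1

lemma notMem_of_mem_openCell {n : ℕ} {i : K.Cell n} (hi : i ∉ L.I n) {x : K.X}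
    (hx : x ∈ K.openCell n i) : x ∉ (L : Set K.X) :=
  fun h => disjoint_left.1
    (RelCWComplex.Subcomplex.disjoint_openCell_subcomplex_of_not_mem L hi) hx h

variable (K L)

/-- The `n`-cells of `K/L`: the `n`-cells of `K` outside `L` and, if `n = 0` (and `L` is not
empty), the point to which `L` is identified. -/
abbrev QuotCell (n : ℕ) : Type u :=
  {i : K.Cell n // i ∉ L.I n} ⊕ {_u : PUnit.{u + 1} // n = 0 ∧ (L : Set K.X).Nonempty}

variable {K L}

/-- The characteristic map in `K/L` of a cell of `K` outside `L`: the composition of that of `K`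
with the quotient map. -/
noncomputable def quotMapInl (n : ℕ) (i : {i : K.Cell n // i ∉ L.I n}) :
    PartialEquiv (Fin n → ℝ) (K.QuotX L) where
  toFun y := K.quotMk L (RelCWComplex.map (C := (univ : Set K.X)) n i.1 y)
  invFun q := (RelCWComplex.map (C := (univ : Set K.X)) n i.1).symm (K.quotOut L q)
  source := ball 0 1
  target := K.quotMk L '' K.openCell n i.1
  map_source' := fun y hy => ⟨_, ⟨y, hy, rfl⟩, rfl⟩
  map_target' := by
    rintro _ ⟨x, hx, rfl⟩
    rw [quotOut_mk (notMem_of_mem_openCell i.2 hx)]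
    obtain ⟨y, hy, rfl⟩ := hx
    rw [← RelCWComplex.source_eq (C := (univ : Set K.X)) n i.1] at hy ⊢
    rwa [PartialEquiv.left_inv _ hy]
  left_inv' := by
    intro y hy
    rw [quotOut_mk (notMem_of_mem_openCell i.2 ⟨y, hy, rfl⟩)]
    rw [← RelCWComplex.source_eq (C := (univ : Set K.X)) n i.1] at hy
    exact PartialEquiv.left_inv _ hy
  right_inv' := by
    rintro _ ⟨x, hx, rfl⟩
    rw [quotOut_mk (notMem_of_mem_openCell i.2 hx)]
    obtain ⟨y, hy, rfl⟩ := hx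
    rw [← RelCWComplex.source_eq (C := (univ : Set K.X)) n i.1] at hy
    rw [PartialEquiv.left_inv _ hy]

/-- The characteristic map of the `0`-cell of `K/L` to which `L` is identified. -/
noncomputable def quotMapInr (n : ℕ)
    (u : {_u : PUnit.{u + 1} // n = 0 ∧ (L : Set K.X).Nonempty}) :
    PartialEquiv (Fin n → ℝ) (K.QuotX L) where
  toFun _ := K.quotMk L u.2.2.some
  invFun _ := 0
  source := ball 0 1
  target := {K.quotMk L u.2.2.some}
  map_source' := fun _ _ => rfl
  map_target' := fun _ _ => by simp
  left_inv' := by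
    intro y _
    obtain ⟨_, rfl, _⟩ := u
    exact Subsingleton.elim _ _
  right_inv' := fun _ h => (mem_singleton_iff.1 h).symm

/-- The characteristic maps of `K/L`. -/
noncomputable def quotMap (n : ℕ) : QuotCell K L n → PartialEquiv (Fin n → ℝ) (K.QuotX L)
  | Sum.inl i => quotMapInl n i
  | Sum.inr u => quotMapInr n u

lemma quotMap_inl (n : ℕ) (i : {i : K.Cell n // i ∉ L.I n}) (y : Fin n → ℝ) :
    quotMap n (Sum.inl i : QuotCell K L n) y =
      K.quotMk L (RelCWComplex.map (C := (univ : Set K.X)) n i.1 y) := rfl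

lemma quotMap_inr (n : ℕ) (u : {_u : PUnit.{u + 1} // n = 0 ∧ (L : Set K.X).Nonempty})
    {x : K.X} (hx : x ∈ (L : Set K.X)) (y : Fin n → ℝ) :
    quotMap n (Sum.inr u : QuotCell K L n) y = K.quotMk L x :=
  quotMk_eq_iff.2 (Or.inr ⟨u.2.2.some_mem, hx⟩)

lemma quot_eventually_isEmpty : ∀ᶠ n in Filter.atTop, IsEmpty (QuotCell K L n) := by
  have h : ∀ᶠ n in Filter.atTop, IsEmpty (K.Cell n) :=
    K.fin.toFiniteDimensional.eventually_isEmpty_cell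
  filter_upwards [h, Filter.eventually_gt_atTop 0] with n hn h0
  constructor
  rintro (i | u)
  · exact hn.false i.1
  · exact h0.ne' u.2.1

lemma quot_finite_cell (n : ℕ) : Finite (QuotCell K L n) := by
  have h : Finite (K.Cell n) := RelCWComplex.FiniteType.finite_cell (C := (univ : Set K.X)) n
  infer_instance

lemma quot_continuousOn (n : ℕ) (i : QuotCell K L n) :
    ContinuousOn (quotMap n i) (closedBall 0 1) := by
  rcases i with i | u
  · exact (K.continuous_quotMk L).comp_continuousOn (RelCWComplex.continuousOn n i.1)
  · exact continuousOn_const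

lemma quot_continuousOn_symm (n : ℕ) (i : QuotCell K L n) :
    ContinuousOn (quotMap n i).symm (quotMap n i).target := by
  rcases i with i | u
  · refine (RelCWComplex.continuousOn_symm (C := (univ : Set K.X)) n i.1).comp
      (continuousOn_quotOut.mono
        (image_mono fun x hx => notMem_of_mem_openCell i.2 hx)) ?_
    rintro _ ⟨x, hx, rfl⟩
    rw [quotOut_mk (notMem_of_mem_openCell i.2 hx)]
    obtain ⟨y, hy, rfl⟩ := hx
    rw [← RelCWComplex.source_eq (C := (univ : Set K.X)) n i.1] at hy
    exact PartialEquiv.map_source _ hy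
  · exact continuousOn_const

lemma quot_pairwiseDisjoint : (univ : Set (Σ n, QuotCell K L n)).PairwiseDisjoint
    (fun ni => quotMap ni.1 ni.2 '' ball 0 1) := by
  rintro ⟨n, i⟩ - ⟨m, j⟩ - hne
  simp only [Function.onFun]
  rw [disjoint_left]
  rintro _ ⟨y, hy, rfl⟩ ⟨z, hz, hyz⟩
  beta_reduce at hyz
  rcases i with i | u <;> rcases j with j | v
  · rw [quotMap_inl, quotMap_inl] at hyz
    rcases quotMk_eq_iff.1 hyz with h | h
    · have hne' : (⟨n, i.1⟩ : Σ n, K.Cell n) ≠ ⟨m, j.1⟩ := by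
        intro h'
        apply hne
        obtain ⟨i, hi⟩ := i
        obtain ⟨j, hj⟩ := j
        obtain ⟨rfl, h''⟩ := Sigma.mk.inj_iff.1 h'
        obtain rfl := eq_of_heq h''
        rfl
      exact disjoint_left.1 (RelCWComplex.disjoint_openCell_of_ne hne') ⟨y, hy, rfl⟩
        ⟨z, hz, h⟩
    · exact notMem_of_mem_openCell i.2 ⟨y, hy, rfl⟩ h.2
  · rw [quotMap_inl, quotMap_inr m v v.2.2.some_mem] at hyz
    rcases quotMk_eq_iff.1 hyz.symm with h | h
    · exact notMem_of_mem_openCell i.2 ⟨y, hy, rfl⟩ (h ▸ v.2.2.some_mem)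
    · exact notMem_of_mem_openCell i.2 ⟨y, hy, rfl⟩ h.1
  · rw [quotMap_inl, quotMap_inr n u u.2.2.some_mem] at hyz
    rcases quotMk_eq_iff.1 hyz with h | h
    · exact notMem_of_mem_openCell j.2 ⟨z, hz, rfl⟩ (h ▸ u.2.2.some_mem)
    · exact notMem_of_mem_openCell j.2 ⟨z, hz, rfl⟩ h.1
  · apply hne
    obtain ⟨u, rfl, hu⟩ := u
    obtain ⟨v, rfl, hv⟩ := v
    rfl

lemma quot_mapsTo (n : ℕ) (i : QuotCell K L n) : MapsTo (quotMap n i) (sphere 0 1)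
    (⋃ (m < n) (j : QuotCell K L m), quotMap m j '' closedBall 0 1) := by
  intro y hy
  rcases i with i | u
  · obtain ⟨I, hI⟩ := CWComplex.mapsTo (C := (univ : Set K.X)) n i.1
    have h := hI hy
    simp only [mem_iUnion] at h ⊢
    obtain ⟨m, hm, j, -, z, hz, hzy⟩ := h
    rw [quotMap_inl]
    by_cases hj : j ∈ L.I m
    · have hL : RelCWComplex.map (C := (univ : Set K.X)) n i.1 y ∈ (L : Set K.X) :=
        RelCWComplex.Subcomplex.closedCell_subset_of_mem L hj ⟨z, hz, hzy⟩
      exact ⟨0, by omega, Sum.inr ⟨PUnit.unit, rfl, _, hL⟩, 0, by simp, quotMap_inr 0 _ hL _⟩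
    · exact ⟨m, hm, Sum.inl ⟨j, hj⟩, z, hz, by rw [quotMap_inl, hzy]⟩
  · obtain ⟨u, rfl, hu⟩ := u
    rw [mem_sphere, Subsingleton.elim y 0] at hy
    simp at hy

lemma quot_union :
    ⋃ (n : ℕ) (j : QuotCell K L n), quotMap n j '' closedBall 0 1 = univ := by
  rw [eq_univ_iff_forall]
  intro q
  obtain ⟨x, rfl⟩ := (K.isQuotientMap_quotMk L).surjective q
  have hx : x ∈ (univ : Set K.X) := mem_univ x
  rw [← CWComplex.union (C := (univ : Set K.X))] at hx
  simp only [mem_iUnion] at hx ⊢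
  obtain ⟨m, j, z, hz, rfl⟩ := hx
  by_cases hj : j ∈ L.I m
  · have hL : RelCWComplex.map (C := (univ : Set K.X)) m j z ∈ (L : Set K.X) :=
      RelCWComplex.Subcomplex.closedCell_subset_of_mem L hj ⟨z, hz, rfl⟩
    exact ⟨0, Sum.inr ⟨PUnit.unit, rfl, _, hL⟩, 0, by simp, quotMap_inr 0 _ hL _⟩
  · exact ⟨m, Sum.inl ⟨j, hj⟩, z, hz, quotMap_inl _ _ _⟩

variable (K L)

/-- The quotient complex `K/L`: the quotient space with the cells of `K` outside `L` and one
`0`-cell, the image of `L`. -/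
noncomputable def quotient : FiniteCW.{u} :=
  letI cw : CWComplex (univ : Set (K.QuotX L)) :=
    CWComplex.mkFinite univ (QuotCell K L) quotMap quot_eventually_isEmpty quot_finite_cell
      (fun _ i => by rcases i with i | u <;> rfl) quot_continuousOn quot_continuousOn_symm
      quot_pairwiseDisjoint quot_mapsTo quot_union
  { X := K.QuotX L
    cw := cw
    fin := CWComplex.finite_mkFinite univ (QuotCell K L) quotMap quot_eventually_isEmpty
      quot_finite_cell (fun _ i => by rcases i with i | u <;> rfl) quot_continuousOn
      quot_continuousOn_symm quot_pairwiseDisjoint quot_mapsTo quot_union }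

end FiniteCW

/-!
The complex `K` and its quotient `K/L` are compared inside the reduced mapping cylinder
`M = K × [-1, 1] / L × {1}` of the quotient map `K → K/L`, which has dimension at most `n + 1`.
Its bottom `K × {-1}` is a copy of `K` and its top `K × {1} / L × {1}` is a copy of `K/L`
(`isoSub_bottom`, `isoSub_top`). It suffices that `M` collapses to both of them.

* `M` collapses to the top as every mapping cylinder does: remove the cells `e` of `K` in an order
  of decreasing dimension; when `e` is due, its copy `e × {-1}` is a free face of `e × [-1, 1]`.
* In the same way, using the free faces `e × {1}`, the cells `e` outside `L` can be removed, which
  leaves the bottom together with the cone on `L` (`collapses_quot_slab` covers both cases).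
  If `a` is a free face of `b` in `L`, then the cone on `a` is a free face of the cone on `b`, so a
  collapse of `L` to a point `x₀` collapses the cone on `L` to the cone on `x₀`
  (`collapses_quot_slab_of_collapses`). This is a segment with the cone point as a free face
  (`elemCollapse_quot_slab_point`).

All collapses but that of the segment are obtained in the cylinder `K × [-1, 1]`, where they remove no cell
of `L × {1}`, and therefore descend to `M` (`ElemCollapse.quot`). They take place between
subcomplexes of one complex; `ElemCollapse.elemCollapsesTo` turns them into elementary collapses
between complexes in their own right.
-/

namespace FiniteCW

open Set Metric

/-! ### Cubes -/

section Cube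

variable {n : ℕ}

lemma mem_ball_iff_init_last {y : Fin (n + 1) → ℝ} : y ∈ ball (0 : Fin (n + 1) → ℝ) 1 ↔
    Fin.init (α := fun _ => ℝ) y ∈ ball (0 : Fin n → ℝ) 1 ∧ |y (Fin.last n)| < 1 := by
  simp only [mem_ball_zero_iff, pi_norm_lt_iff one_pos, Fin.forall_fin_succ', Real.norm_eq_abs]
  rfl

lemma mem_closedBall_iff_init_last {y : Fin (n + 1) → ℝ} :
    y ∈ closedBall (0 : Fin (n + 1) → ℝ) 1 ↔
    Fin.init (α := fun _ => ℝ) y ∈ closedBall (0 : Fin n → ℝ) 1 ∧ |y (Fin.last n)| ≤ 1 := by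
  simp only [mem_closedBall_zero_iff, pi_norm_le_iff_of_nonneg zero_le_one, Fin.forall_fin_succ',
    Real.norm_eq_abs]
  rfl

lemma mem_sphere_iff_closedBall_ball {y : Fin n → ℝ} : y ∈ sphere (0 : Fin n → ℝ) 1 ↔
    y ∈ closedBall (0 : Fin n → ℝ) 1 ∧ y ∉ ball (0 : Fin n → ℝ) 1 := by
  rw [← closedBall_sdiff_ball]
  rfl

lemma mem_sphere_iff_init_last {y : Fin (n + 1) → ℝ} : y ∈ sphere (0 : Fin (n + 1) → ℝ) 1 ↔
    (Fin.init (α := fun _ => ℝ) y ∈ closedBall (0 : Fin n → ℝ) 1 ∧ |y (Fin.last n)| ≤ 1) ∧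
    (Fin.init (α := fun _ => ℝ) y ∈ sphere (0 : Fin n → ℝ) 1 ∨ |y (Fin.last n)| = 1) := by
  rw [mem_sphere_iff_closedBall_ball, mem_closedBall_iff_init_last, mem_ball_iff_init_last,
    mem_sphere_iff_closedBall_ball]
  constructor
  · rintro ⟨⟨h1, h2⟩, h⟩
    refine ⟨⟨h1, h2⟩, ?_⟩
    by_cases h3 : Fin.init (α := fun _ => ℝ) y ∈ ball (0 : Fin n → ℝ) 1
    · exact Or.inr (le_antisymm h2 (not_lt.1 fun h4 => h ⟨h3, h4⟩))
    · exact Or.inl ⟨h1, h3⟩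
  · rintro ⟨h, h' | h'⟩
    · exact ⟨h, fun h3 => h'.2 h3.1⟩
    · exact ⟨h, fun h3 => h3.2.ne h'⟩

lemma continuous_finInit : Continuous (fun y : Fin (n + 1) → ℝ => Fin.init (α := fun _ => ℝ) y) :=
  continuous_pi fun i => continuous_apply i.castSucc

/-- The closure of the complement of the top face in the boundary of the cube meets the top face
only in the boundary of the latter. -/
lemma init_mem_sphere_of_mem_closure {y : Fin (n + 1) → ℝ}
    (hy : y ∈ closure (sphere 0 1 \ {x : Fin (n + 1) → ℝ | x (Fin.last n) = 1}))
    (hlast : y (Fin.last n) = 1) : Fin.init (α := fun _ => ℝ) y ∈ sphere (0 : Fin n → ℝ) 1 := by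
  have hys : y ∈ sphere (0 : Fin (n + 1) → ℝ) 1 :=
    closure_minimal sdiff_subset isClosed_sphere hy
  rw [mem_sphere_iff_init_last] at hys
  rw [mem_sphere_iff_closedBall_ball]
  refine ⟨hys.1.1, fun hb => ?_⟩
  have ho : IsOpen ({z : Fin (n + 1) → ℝ | Fin.init (α := fun _ => ℝ) z ∈ ball (0 : Fin n → ℝ) 1} ∩
      {z | 0 < z (Fin.last n)}) :=
    (isOpen_ball.preimage continuous_finInit).inter
      (isOpen_lt continuous_const (continuous_apply _))
  obtain ⟨z, ⟨hz1, hz2⟩, hz3, hz4⟩ := mem_closure_iff.1 hy _ ho ⟨hb, by simp [hlast]⟩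
  rw [mem_sphere_iff_init_last] at hz3
  rcases hz3.2 with h | h
  · exact (mem_sphere_iff_closedBall_ball.1 h).2 hz1
  · exact hz4 (by rwa [abs_of_pos hz2] at h)

end Cube

/-! ### Cells, subcomplexes and skeleta -/

variable {K : FiniteCW.{u}}

lemma exists_mem_openCell (x : K.X) : ∃ (n : ℕ) (i : K.Cell n), x ∈ K.openCell n i := by
  have h : x ∈ (univ : Set K.X) := mem_univ x
  rw [← CWComplex.iUnion_openCell_eq_complex (C := (univ : Set K.X))] at h
  simpa only [mem_iUnion] using h

lemma cell_eq_of_mem {x : K.X} {n m : ℕ} {i : K.Cell n} {j : K.Cell m}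
    (hi : x ∈ K.openCell n i) (hj : x ∈ K.openCell m j) : (⟨n, i⟩ : Σ n, K.Cell n) = ⟨m, j⟩ :=
  RelCWComplex.eq_of_not_disjoint_openCell fun h => disjoint_left.1 h hi hj

lemma mem_skeletonLT {n : ℕ} {x : K.X} :
    x ∈ (RelCWComplex.skeletonLT (univ : Set K.X) n : Set K.X) ↔
      ∃ m < n, ∃ j : K.Cell m, x ∈ K.openCell m j := by
  refine CWComplex.mem_skeletonLT_iff.trans ?_
  simp only [Nat.cast_lt, exists_prop]

lemma mem_skeletonLT_iff_lt {n m : ℕ} {i : K.Cell m} {x : K.X} (hx : x ∈ K.openCell m i) :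
    x ∈ (RelCWComplex.skeletonLT (univ : Set K.X) n : Set K.X) ↔ m < n := by
  rw [mem_skeletonLT]
  constructor
  · rintro ⟨k, hk, j, hj⟩
    rwa [(Sigma.mk.inj_iff.1 (cell_eq_of_mem hx hj)).1]
  · exact fun h => ⟨m, h, i, hx⟩

lemma Sub.mem_I_iff {F : K.Sub} {n : ℕ} {i : K.Cell n} :
    i ∈ F.I n ↔ K.openCell n i ⊆ F := by
  refine ⟨fun h => RelCWComplex.Subcomplex.openCell_subset_of_mem F h, fun h => ?_⟩
  by_contra hi
  obtain ⟨x, hx⟩ := RelCWComplex.openCell_nonempty (C := (univ : Set K.X)) n i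
  exact notMem_of_mem_openCell hi hx (h hx)

lemma Sub.notMem_I_of_notMem {F : K.Sub} {n : ℕ} {i : K.Cell n} {x : K.X}
    (hx : x ∈ K.openCell n i) (hF : x ∉ (F : Set K.X)) : i ∉ F.I n :=
  fun h => hF (Sub.mem_I_iff.1 h hx)

lemma Sub.openCell_subset_of_mem {F : K.Sub} {n : ℕ} {i : K.Cell n} {x : K.X}
    (hx : x ∈ K.openCell n i) (hF : x ∈ (F : Set K.X)) : K.openCell n i ⊆ F :=
  Sub.mem_I_iff.1 (by_contra fun h => notMem_of_mem_openCell h hx hF)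

/-- The skeleton of a subcomplex is its intersection with the skeleton of the whole complex. -/
lemma Sub.mem_skeleton {F : K.Sub} {m : ℕ} {x : K.X} :
    x ∈ (RelCWComplex.skeleton (F : Set K.X) m : Set K.X) ↔
      x ∈ (F : Set K.X) ∧
        x ∈ (RelCWComplex.skeletonLT (univ : Set K.X) ((m + 1 : ℕ) : ℕ∞) : Set K.X) := by
  rw [mem_skeletonLT]
  refine CWComplex.mem_skeletonLT_iff.trans ?_
  constructor
  · rintro ⟨k, hk, j, hx⟩
    exact ⟨Sub.mem_I_iff.1 j.2 hx, k, by exact_mod_cast hk, j.1, hx⟩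
  · rintro ⟨hF, k, hk, j, hx⟩
    exact ⟨k, by exact_mod_cast hk, ⟨j, Sub.mem_I_iff.2 (Sub.openCell_subset_of_mem hx hF)⟩, hx⟩

/-- A closed set that contains every open cell it meets, as a subcomplex. -/
def Sub.ofCellular (A : Set K.X) (hA : IsClosed A)
    (h : ∀ (n : ℕ) (i : K.Cell n), ∀ x ∈ K.openCell n i, x ∈ A → K.openCell n i ⊆ A) : K.Sub where
  carrier := A
  I := fun n => {i | K.openCell n i ⊆ A}
  closed' := hA
  union' := by
    rw [empty_union]
    ext x
    simp only [mem_iUnion]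
    constructor
    · rintro ⟨n, i, hx⟩
      exact i.2 hx
    · intro hx
      obtain ⟨n, i, hi⟩ := exists_mem_openCell x
      exact ⟨n, ⟨i, h n i x hi hx⟩, hi⟩

lemma Sub.coe_injective {E F : K.Sub} (h : (E : Set K.X) = F) : E = F :=
  SetLike.coe_injective h

/-! ### Characteristic maps -/

lemma isEmbedding_map (n : ℕ) (i : K.Cell n) :
    IsEmbedding ((ball (0 : Fin n → ℝ) 1).domRestrict
      (RelCWComplex.map (C := (univ : Set K.X)) n i)) := by
  set e := RelCWComplex.map (C := (univ : Set K.X)) n i with he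
  have hs : e.source = ball 0 1 := RelCWComplex.source_eq (C := (univ : Set K.X)) n i
  have hc : Continuous ((ball (0 : Fin n → ℝ) 1).domRestrict e) :=
    continuousOn_iff_continuous_domRestrict.1
      ((RelCWComplex.continuousOn (C := (univ : Set K.X)) n i).mono ball_subset_closedBall)
  have ht : ∀ y : ball (0 : Fin n → ℝ) 1, e y ∈ e.target :=
    fun y => e.map_source (by rw [hs]; exact y.2)
  have hc' : Continuous (Set.codRestrict ((ball (0 : Fin n → ℝ) 1).domRestrict e) e.target ht) :=
    hc.codRestrict ht
  have h1 : IsEmbedding (Set.codRestrict ((ball (0 : Fin n → ℝ) 1).domRestrict e) e.target ht) := by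
    refine IsEmbedding.of_comp hc' (continuousOn_iff_continuous_domRestrict.1
      (RelCWComplex.continuousOn_symm (C := (univ : Set K.X)) n i)) ?_
    convert! IsEmbedding.subtypeVal using 1
    ext1 y
    exact e.left_inv (by rw [hs]; exact y.2)
  exact IsEmbedding.subtypeVal.comp h1

lemma isCharMap_map (n : ℕ) (i : K.Cell n) :
    K.IsCharMap n i (RelCWComplex.map (C := (univ : Set K.X)) n i) where
  continuousOn := RelCWComplex.continuousOn n i
  isEmbedding := isEmbedding_map n i
  image_ball := rfl
  mapsTo_sphere := by
    rw [mapsTo_iff_image_subset]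
    exact RelCWComplex.cellFrontier_subset_skeletonLT (C := (univ : Set K.X)) n i

namespace IsCharMap

variable {n : ℕ} {i : K.Cell n} {ψ : (Fin n → ℝ) → K.X}

lemma mem_openCell (h : K.IsCharMap n i ψ) {y : Fin n → ℝ} (hy : y ∈ ball (0 : Fin n → ℝ) 1) :
    ψ y ∈ K.openCell n i :=
  h.image_ball ▸ mem_image_of_mem ψ hy

lemma notMem_openCell (h : K.IsCharMap n i ψ) {y : Fin n → ℝ}
    (hy : y ∈ sphere (0 : Fin n → ℝ) 1) : ψ y ∉ K.openCell n i :=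
  fun hi => lt_irrefl _ ((mem_skeletonLT_iff_lt hi).1 (h.mapsTo_sphere hy))

lemma mapsTo_closedBall (h : K.IsCharMap n i ψ) {E : Set K.X} (hE : IsClosed E)
    (hi : K.openCell n i ⊆ E) : MapsTo ψ (closedBall 0 1) E := by
  rw [← closure_ball (0 : Fin n → ℝ) one_ne_zero]
  have hc := h.continuousOn
  rw [← closure_ball (0 : Fin n → ℝ) one_ne_zero] at hc
  rw [mapsTo_iff_image_subset]
  refine hc.image_closure.trans (closure_minimal ?_ hE)
  rwa [h.image_ball]

/-- Characteristic maps may be precomposed with norm-preserving self-homeomorphisms of `ℝⁿ`. -/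
lemma comp_homeomorph (h : K.IsCharMap n i ψ) (σ : (Fin n → ℝ) ≃ₜ (Fin n → ℝ))
    (hσ : ∀ y, ‖σ y‖ = ‖y‖) : K.IsCharMap n i (ψ ∘ σ) where
  continuousOn := h.continuousOn.comp σ.continuous.continuousOn fun y hy => by
    simpa [hσ] using hy
  isEmbedding := by
    have hm : MapsTo σ (ball (0 : Fin n → ℝ) 1) (ball (0 : Fin n → ℝ) 1) := fun y hy => by
      simpa [hσ] using hy
    have h1 : IsEmbedding (hm.restrict σ _ _) := by
      refine IsEmbedding.of_comp (σ.continuous.restrict hm) continuous_subtype_val ?_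
      exact σ.isEmbedding.comp IsEmbedding.subtypeVal
    exact h.isEmbedding.comp h1
  image_ball := by
    rw [image_comp, ← h.image_ball]
    congr 1
    ext y
    constructor
    · rintro ⟨z, hz, rfl⟩
      simpa [hσ] using hz
    · intro hy
      refine ⟨σ.symm y, ?_, σ.apply_symm_apply y⟩
      rw [mem_ball_zero_iff, ← hσ, σ.apply_symm_apply]
      simpa using hy
  mapsTo_sphere := fun y hy => h.mapsTo_sphere (by simpa [hσ] using hy)

end IsCharMap

/-- A description of elementary collapses in which the condition on the complement of the free
face is reduced to what is not automatic: that no point of the boundary outside the face is mapped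
to the free cell. -/
lemma elemCollapse_iff {E F : K.Sub} : ElemCollapse E F ↔
    ∃ (m : ℕ) (a : K.Cell m) (b : K.Cell (m + 1)),
      a ∉ F.I m ∧ b ∉ F.I (m + 1) ∧
      (E : Set K.X) = (F : Set K.X) ∪ K.openCell m a ∪ K.openCell (m + 1) b ∧
      ∃ ψ : (Fin (m + 1) → ℝ) → K.X,
        K.IsCharMap (m + 1) b ψ ∧
        K.IsCharMap m a (fun y => ψ (Fin.snoc (α := fun _ => ℝ) y 1)) ∧
        ∀ y ∈ sphere (0 : Fin (m + 1) → ℝ) 1, y (Fin.last m) ≠ 1 → ψ y ∉ K.openCell m a := by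
  constructor
  · rintro ⟨m, a, b, ha, hb, hE, ψ, hψ, hψa, hm⟩
    refine ⟨m, a, b, ha, hb, hE, ψ, hψ, hψa, fun y hy hlast h => ?_⟩
    exact notMem_of_mem_openCell ha h (Sub.mem_skeleton.1 (hm (subset_closure ⟨hy, hlast⟩))).1
  · rintro ⟨m, a, b, ha, hb, hE, ψ, hψ, hψa, hm⟩
    refine ⟨m, a, b, ha, hb, hE, ψ, hψ, hψa, fun y hy => Sub.mem_skeleton.2 ?_⟩
    have hys : y ∈ sphere (0 : Fin (m + 1) → ℝ) 1 :=
      closure_minimal sdiff_subset isClosed_sphere hy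
    refine ⟨?_, hψ.mapsTo_sphere hys⟩
    have hyE : ψ y ∈ (E : Set K.X) :=
      hψ.mapsTo_closedBall (sub_closed E) (hE ▸ subset_union_right)
        (sphere_subset_closedBall hys)
    rw [hE] at hyE
    rcases hyE with (h | h) | h
    · exact h
    · exfalso
      by_cases hlast : y (Fin.last m) = 1
      · refine hψa.notMem_openCell (init_mem_sphere_of_mem_closure hy hlast) ?_
        rwa [← hlast, Fin.snoc_init_self]
      · exact hm y hys hlast h
    · exact absurd h (hψ.notMem_openCell hys)

/-! ### Construction of finite CW complexes from characteristic maps -/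

section OfCharMaps

/-- A map that is an embedding on `s`, as a partial equivalence. -/
noncomputable def partialEquivOfEmbedding {n : ℕ} {X : Type u} [TopologicalSpace X]
    {s : Set (Fin n → ℝ)} (ψ : (Fin n → ℝ) → X) (h : IsEmbedding (s.domRestrict ψ)) :
    PartialEquiv (Fin n → ℝ) X :=
  BijOn.toPartialEquiv ψ s (ψ '' s) (injOn_iff_injective.2 h.injective).bijOn_image

lemma continuousOn_partialEquivOfEmbedding_symm {n : ℕ} {X : Type u} [TopologicalSpace X]
    {s : Set (Fin n → ℝ)} (ψ : (Fin n → ℝ) → X) (h : IsEmbedding (s.domRestrict ψ)) :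
    ContinuousOn (partialEquivOfEmbedding ψ h).symm (partialEquivOfEmbedding ψ h).target := by
  set e := partialEquivOfEmbedding ψ h
  have hm : MapsTo e.symm e.target s := fun x hx => e.map_target hx
  have hc : Continuous (hm.restrict e.symm _ _) := by
    rw [h.isInducing.continuous_iff]
    convert! continuous_subtype_val using 1
    ext1 x
    exact e.right_inv x.2
  exact continuousOn_iff_continuous_domRestrict.2 (continuous_subtype_val.comp hc)

/-- The finite CW complex with cells indexed by `cell` and characteristic maps `φ`. -/
noncomputable def ofCharMaps (X : Type u) [TopologicalSpace X] [T2Space X] (cell : ℕ → Type u)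
    (φ : ∀ n, cell n → (Fin n → ℝ) → X)
    (h_empty : ∀ᶠ n in Filter.atTop, IsEmpty (cell n)) (h_fin : ∀ n, Finite (cell n))
    (h_cont : ∀ n i, ContinuousOn (φ n i) (closedBall 0 1))
    (h_emb : ∀ n i, IsEmbedding ((ball (0 : Fin n → ℝ) 1).domRestrict (φ n i)))
    (h_disj : ∀ n i m j, ∀ y ∈ ball (0 : Fin n → ℝ) 1, ∀ z ∈ ball (0 : Fin m → ℝ) 1,
      φ n i y = φ m j z → (⟨n, i⟩ : Σ n, cell n) = ⟨m, j⟩)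
    (h_maps : ∀ n i, ∀ y ∈ sphere (0 : Fin n → ℝ) 1,
      ∃ m < n, ∃ j, φ n i y ∈ φ m j '' ball (0 : Fin m → ℝ) 1)
    (h_union : ∀ x, ∃ n i, x ∈ φ n i '' ball (0 : Fin n → ℝ) 1) : FiniteCW.{u} :=
  have h_disj' : (univ : Set (Σ n, cell n)).PairwiseDisjoint
      (fun ni => partialEquivOfEmbedding (φ ni.1 ni.2) (h_emb ni.1 ni.2) '' ball 0 1) := by
    rintro ⟨n, i⟩ - ⟨m, j⟩ - hne
    refine disjoint_left.2 ?_
    rintro _ ⟨y, hy, rfl⟩ ⟨z, hz, hyz⟩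
    exact hne (h_disj n i m j y hy z hz hyz.symm)
  have h_maps' : ∀ n i, MapsTo (partialEquivOfEmbedding (φ n i) (h_emb n i)) (sphere 0 1)
      (⋃ (m < n) (j : cell m),
        partialEquivOfEmbedding (φ m j) (h_emb m j) '' closedBall 0 1) := by
    intro n i y hy
    simp only [mem_iUnion]
    obtain ⟨m, hm, j, hj⟩ := h_maps n i y hy
    exact ⟨m, hm, j, image_mono ball_subset_closedBall hj⟩
  have h_union' : ⋃ (n : ℕ) (j : cell n),
      partialEquivOfEmbedding (φ n j) (h_emb n j) '' closedBall 0 1 = univ := by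
    refine eq_univ_iff_forall.2 fun x => ?_
    simp only [mem_iUnion]
    obtain ⟨m, j, hj⟩ := h_union x
    exact ⟨m, j, image_mono ball_subset_closedBall hj⟩
  letI cw : CWComplex (univ : Set X) :=
    CWComplex.mkFinite univ cell (fun n i => partialEquivOfEmbedding (φ n i) (h_emb n i)) h_empty
      h_fin (fun _ _ => rfl) h_cont
      (fun n i => continuousOn_partialEquivOfEmbedding_symm (φ n i) (h_emb n i))
      h_disj' h_maps' h_union'
  { X := X
    cw := cw
    fin := CWComplex.finite_mkFinite univ cell
      (fun n i => partialEquivOfEmbedding (φ n i) (h_emb n i)) h_empty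
      h_fin (fun _ _ => rfl) h_cont
      (fun n i => continuousOn_partialEquivOfEmbedding_symm (φ n i) (h_emb n i))
      h_disj' h_maps' h_union' }

end OfCharMaps

/-! ### Subcomplexes as complexes -/

lemma finite_cell (K : FiniteCW.{u}) (n : ℕ) : Finite (K.Cell n) :=
  RelCWComplex.FiniteType.finite_cell (C := (univ : Set K.X)) n

lemma eventually_isEmpty_cell (K : FiniteCW.{u}) :
    ∀ᶠ n in Filter.atTop, IsEmpty (K.Cell n) :=
  K.fin.toFiniteDimensional.eventually_isEmpty_cell

/-- The characteristic map of a cell of the subcomplex `E`, as a map into `E`. Only its values on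
the closed cube matter. -/
noncomputable def Sub.charMap (E : K.Sub) (n : ℕ) (i : E.I n) (y : Fin n → ℝ) :
    (E : Set K.X) :=
  open Classical in
  if h : RelCWComplex.map (C := (univ : Set K.X)) n i.1 y ∈ (E : Set K.X) then ⟨_, h⟩ else
    ⟨RelCWComplex.map (C := (univ : Set K.X)) n i.1 0, Sub.mem_I_iff.1 i.2
      (RelCWComplex.map_zero_mem_openCell (C := (univ : Set K.X)) n i.1)⟩

lemma Sub.coe_charMap {E : K.Sub} {n : ℕ} (i : E.I n) {y : Fin n → ℝ}
    (hy : y ∈ closedBall (0 : Fin n → ℝ) 1) :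
    (E.charMap n i y : K.X) = RelCWComplex.map (C := (univ : Set K.X)) n i.1 y := by
  have h := (isCharMap_map n i.1).mapsTo_closedBall (sub_closed E) (Sub.mem_I_iff.1 i.2) hy
  rw [Sub.charMap, dif_pos h]

lemma Sub.coe_image_charMap {E : K.Sub} {n : ℕ} (i : E.I n) :
    Subtype.val '' (E.charMap n i '' ball 0 1) = K.openCell n i.1 := by
  rw [image_image]
  exact image_congr fun y hy => Sub.coe_charMap i (ball_subset_closedBall hy)

lemma Sub.mem_image_charMap {E : K.Sub} {n : ℕ} {i : E.I n} {x : (E : Set K.X)} :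
    x ∈ E.charMap n i '' ball 0 1 ↔ x.1 ∈ K.openCell n i.1 := by
  rw [← Sub.coe_image_charMap, Subtype.val_injective.mem_set_image]

/-- A subcomplex as a complex in its own right. -/
noncomputable def Sub.toCW (E : K.Sub) : FiniteCW.{u} :=
  ofCharMaps (E : Set K.X) (fun n => E.I n) E.charMap
    (by
      filter_upwards [K.eventually_isEmpty_cell] with n hn
      exact ⟨fun i => hn.false i.1⟩)
    (fun n => by
      have := K.finite_cell n
      infer_instance)
    (fun n i => by
      rw [IsEmbedding.subtypeVal.isInducing.continuousOn_iff]
      exact (RelCWComplex.continuousOn (C := (univ : Set K.X)) n i.1).congr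
        fun y hy => Sub.coe_charMap i hy)
    (fun n i => by
      rw [← IsEmbedding.subtypeVal.of_comp_iff]
      convert! isEmbedding_map n i.1 using 1
      ext1 y
      exact Sub.coe_charMap i (ball_subset_closedBall y.2))
    (fun n i m j y hy z hz h => by
      have h1 : (E.charMap n i y).1 ∈ K.openCell n i.1 :=
        Sub.mem_image_charMap.1 ⟨y, hy, rfl⟩
      have h2 : (E.charMap n i y).1 ∈ K.openCell m j.1 :=
        Sub.mem_image_charMap.1 ⟨z, hz, h.symm⟩
      obtain ⟨rfl, h'⟩ := Sigma.mk.inj_iff.1 (cell_eq_of_mem h1 h2)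
      rw [Subtype.ext (eq_of_heq h')])
    (fun n i y hy => by
      have h := (isCharMap_map n i.1).mapsTo_sphere hy
      rw [← Sub.coe_charMap i (sphere_subset_closedBall hy), mem_skeletonLT] at h
      obtain ⟨m, hm, j, hj⟩ := h
      exact ⟨m, hm, ⟨j, Sub.mem_I_iff.2 (Sub.openCell_subset_of_mem hj (Subtype.prop _))⟩,
        Sub.mem_image_charMap.2 hj⟩)
    (fun x => by
      obtain ⟨n, i, hi⟩ := exists_mem_openCell x.1
      exact ⟨n, ⟨i, Sub.mem_I_iff.2 (Sub.openCell_subset_of_mem hi x.2)⟩,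
        Sub.mem_image_charMap.2 hi⟩)

lemma Sub.isoSub_toCW (E : K.Sub) : E.toCW.IsoSub E :=
  ⟨fun x : E.toCW.X => Subtype.val (p := fun x => x ∈ (E : Set K.X)) x, IsEmbedding.subtypeVal, Subtype.range_val,
    fun _ i => ⟨i.1, Sub.coe_image_charMap i⟩⟩

/-! ### Transport along isomorphisms onto subcomplexes -/

section IsoSub

variable {M A B : FiniteCW.{u}} {E F : M.Sub}

lemma exists_cell_of_image {f : A.X → M.X}
    (hf : ∀ (n : ℕ) (i : A.Cell n), ∃ j : M.Cell n, f '' A.openCell n i = M.openCell n j)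
    {n : ℕ} (c : M.Cell n) (hc : M.openCell n c ⊆ range f) :
    ∃ c' : A.Cell n, f '' A.openCell n c' = M.openCell n c := by
  obtain ⟨x, hx⟩ := RelCWComplex.openCell_nonempty (C := (univ : Set M.X)) n c
  obtain ⟨y, rfl⟩ := hc hx
  obtain ⟨m, i, hi⟩ := exists_mem_openCell y
  obtain ⟨j, hj⟩ := hf m i
  have hyj : f y ∈ M.openCell m j := hj ▸ mem_image_of_mem f hi
  obtain ⟨rfl, h⟩ := Sigma.mk.inj_iff.1 (cell_eq_of_mem hx hyj)
  exact ⟨i, by rw [hj, eq_of_heq h]⟩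

lemma IsCharMap.of_isEmbedding {f : A.X → M.X} (hf : IsEmbedding f)
    (hcell : ∀ (n : ℕ) (i : A.Cell n), ∃ j : M.Cell n, f '' A.openCell n i = M.openCell n j)
    {n : ℕ} {c : M.Cell n} {c' : A.Cell n} (hc : f '' A.openCell n c' = M.openCell n c)
    {ψ : (Fin n → ℝ) → M.X} (hψ : M.IsCharMap n c ψ) {ψ' : (Fin n → ℝ) → A.X}
    (h : ∀ y ∈ closedBall (0 : Fin n → ℝ) 1, f (ψ' y) = ψ y) : A.IsCharMap n c' ψ' where
  continuousOn := by
    rw [hf.isInducing.continuousOn_iff]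
    exact hψ.continuousOn.congr h
  isEmbedding := by
    rw [← hf.of_comp_iff]
    convert! hψ.isEmbedding using 1
    ext1 y
    exact h y (ball_subset_closedBall y.2)
  image_ball := by
    refine hf.injective.image_injective ?_
    rw [hc, ← hψ.image_ball, image_image]
    exact image_congr fun y hy => h y (ball_subset_closedBall hy)
  mapsTo_sphere := fun y hy => by
    obtain ⟨m, i, hi⟩ := exists_mem_openCell (ψ' y)
    obtain ⟨j, hj⟩ := hcell m i
    have hyj : f (ψ' y) ∈ M.openCell m j := hj ▸ mem_image_of_mem f hi
    rw [mem_skeletonLT_iff_lt hi, ← mem_skeletonLT_iff_lt hyj, h y (sphere_subset_closedBall hy)]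
    exact hψ.mapsTo_sphere hy

/-- An elementary collapse between subcomplexes is an elementary collapse between any complexes
isomorphic to them. -/
lemma ElemCollapse.elemCollapsesTo (h : ElemCollapse E F) (hA : A.IsoSub E) (hB : B.IsoSub F) :
    A.ElemCollapsesTo B := by
  obtain ⟨f, hf, hfE, hfc⟩ := hA
  obtain ⟨g, hg, hgF, hgc⟩ := hB
  obtain ⟨m, a, b, ha, hb, hE, ψ, hψ, hψa, hm⟩ := elemCollapse_iff.1 h
  have hFE : (F : Set M.X) ⊆ range f := by
    rw [hfE, hE]
    exact subset_union_left.trans subset_union_left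
  have haE : M.openCell m a ⊆ range f := by
    rw [hfE, hE]
    exact subset_union_right.trans subset_union_left
  have hbE : M.openCell (m + 1) b ⊆ range f := by
    rw [hfE, hE]
    exact subset_union_right
  obtain ⟨a', ha'⟩ := exists_cell_of_image hfc a haE
  obtain ⟨b', hb'⟩ := exists_cell_of_image hfc b hbE
  have hmem : ∀ {n : ℕ} {c : M.Cell n} {c' : A.Cell n}, f '' A.openCell n c' = M.openCell n c →
      ∀ x, f x ∈ M.openCell n c ↔ x ∈ A.openCell n c' := fun hc x => by
    rw [← hc, hf.injective.mem_set_image]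
  have : Nonempty A.X :=
    (RelCWComplex.openCell_nonempty (C := (univ : Set A.X)) m a').to_type
  let F' : A.Sub := Sub.ofCellular (f ⁻¹' F) ((sub_closed F).preimage hf.continuous)
    fun n i x hx hxF => by
      obtain ⟨j, hj⟩ := hfc n i
      have hxj : f x ∈ M.openCell n j := hj ▸ mem_image_of_mem f hx
      rw [← image_subset_iff, hj]
      exact Sub.openCell_subset_of_mem hxj hxF
  have hnot : ∀ {n : ℕ} {c : M.Cell n} {c' : A.Cell n}, f '' A.openCell n c' = M.openCell n c →
      c ∉ F.I n → c' ∉ F'.I n := by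
    intro n c c' hc hcF
    obtain ⟨x, hx⟩ := RelCWComplex.openCell_nonempty (C := (univ : Set A.X)) n c'
    exact Sub.notMem_I_of_notMem hx
      (show f x ∉ (F : Set M.X) from notMem_of_mem_openCell hcF ((hmem hc x).2 hx))
  have hψE : ∀ y ∈ closedBall (0 : Fin (m + 1) → ℝ) 1,
      f (Function.invFun f (ψ y)) = ψ y := fun y hy => by
    refine Function.invFun_eq (?_ : ψ y ∈ range f)
    rw [hfE]
    exact hψ.mapsTo_closedBall (sub_closed E) (hfE ▸ hbE) hy
  refine ⟨F', elemCollapse_iff.2 ⟨m, a', b', hnot ha' ha, hnot hb' hb, ?_,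
    fun y => Function.invFun f (ψ y), hψ.of_isEmbedding hf hfc hb' hψE,
    hψa.of_isEmbedding hf hfc ha' fun y hy => hψE _ ?_, ?_⟩, ?_⟩
  · refine (eq_univ_iff_forall.2 fun x => ?_).symm
    have hx : f x ∈ (E : Set M.X) := hfE ▸ mem_range_self x
    rw [hE] at hx
    rcases hx with (hx | hx) | hx
    · exact Or.inl (Or.inl hx)
    · exact Or.inl (Or.inr ((hmem ha' x).1 hx))
    · exact Or.inr ((hmem hb' x).1 hx)
  · rw [mem_closedBall_iff_init_last]
    simpa using hy
  · intro y hy hlast h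
    refine hm y hy hlast ?_
    rw [← hψE y (sphere_subset_closedBall hy)]
    exact (hmem ha' _).2 h
  · have hfg : ∀ x, f (Function.invFun f (g x)) = g x := fun x =>
      Function.invFun_eq (hFE (hgF ▸ mem_range_self x) : g x ∈ range f)
    refine ⟨fun x => Function.invFun f (g x), ?_, ?_, fun n i => ?_⟩
    · rw [← hf.of_comp_iff]
      convert! hg using 1
      ext1 x
      exact hfg x
    · ext x
      constructor
      · rintro ⟨z, rfl⟩
        change f (Function.invFun f (g z)) ∈ (F : Set M.X)
        rw [hfg, ← hgF]
        exact mem_range_self z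
      · intro hx
        obtain ⟨z, hz⟩ : f x ∈ range g := hgF ▸ hx
        exact ⟨z, hf.injective ((hfg z).trans hz)⟩
    · obtain ⟨j, hj⟩ := hgc n i
      obtain ⟨j', hj'⟩ := exists_cell_of_image hfc j
        (hj ▸ ((image_subset_range _ _).trans (hgF.le.trans hFE)))
      refine ⟨j', hf.injective.image_injective ?_⟩
      rw [hj', ← hj, image_image]
      exact image_congr fun x _ => hfg x

lemma DimLE.of_isoSub {n : ℕ} (hM : M.DimLE n) (hA : A.IsoSub E) : A.DimLE n := by
  obtain ⟨f, -, -, hf⟩ := hA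
  exact fun m hm => ⟨fun i => (hM m hm).false (hf m i).choose⟩

end IsoSub

/-! ### Deformations -/

/-- One step of an `n`-deformation. -/
def DeformStep (n : ℕ) (A B : FiniteCW.{u}) : Prop :=
  (A.ElemCollapsesTo B ∨ B.ElemCollapsesTo A) ∧ A.DimLE n ∧ B.DimLE n

instance (n : ℕ) : Std.Symm (DeformStep.{u} n) :=
  ⟨fun _ _ h => ⟨h.1.symm, h.2.2, h.2.1⟩⟩

lemma deforms_of_reflTransGen {n : ℕ} {A B : FiniteCW.{u}}
    (h : Relation.ReflTransGen (DeformStep n) A B) (hB : B.DimLE n) : Deforms n A B := by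
  induction h using Relation.ReflTransGen.head_induction_on with
  | refl => exact ⟨0, fun _ => B, rfl, rfl, fun i hi => absurd hi (by omega), fun _ _ => hB⟩
  | @head A A' hA _ ih =>
    obtain ⟨r, F, h0, hr, hs, hd⟩ := ih
    refine ⟨r + 1, fun i => Nat.casesOn i A F, rfl, hr, ?_, ?_⟩
    · rintro (_ | i) hi
      · change A.ElemCollapsesTo (F 0) ∨ (F 0).ElemCollapsesTo A
        rw [h0]
        exact hA.1
      · exact hs i (by omega)
    · rintro (_ | i) hi
      · exact hA.2.1
      · exact hd i (by omega)

/-- A nonempty sequence of elementary collapses between subcomplexes is a deformation between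
complexes isomorphic to its ends. -/
lemma reflTransGen_deformStep {n : ℕ} {M A B : FiniteCW.{u}} (hM : M.DimLE n) {E F : M.Sub}
    (h : Relation.TransGen ElemCollapse E F) (hA : A.IsoSub E) (hB : B.IsoSub F) :
    Relation.ReflTransGen (DeformStep n) A B := by
  induction h using Relation.TransGen.head_induction_on generalizing A with
  | single h =>
    exact .single ⟨Or.inl (h.elemCollapsesTo hA hB), hM.of_isoSub hA, hM.of_isoSub hB⟩
  | head h _ ih =>
    exact .head ⟨Or.inl (h.elemCollapsesTo hA (Sub.isoSub_toCW _)), hM.of_isoSub hA,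
      hM.of_isoSub (Sub.isoSub_toCW _)⟩ (ih (Sub.isoSub_toCW _))

/-! ### Collapses of a quotient -/

section Quotient

variable {K : FiniteCW.{u}} {L : K.Sub}

/-- The quotient map from `K` to the complex `K/L`. -/
def quotProj (L : K.Sub) : K.X → (K.quotient L).X := K.quotMk L

/-- The cell of `K/L` that is the image of a cell of `K` outside `L`. -/
def quotCell {n : ℕ} (i : K.Cell n) (hi : i ∉ L.I n) : (K.quotient L).Cell n :=
  (Sum.inl ⟨i, hi⟩ : QuotCell K L n)

/-- The `0`-cell of `K/L` that is the image of `L`. -/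
def quotPoint (hL : (L : Set K.X).Nonempty) : (K.quotient L).Cell 0 :=
  (Sum.inr ⟨PUnit.unit, rfl, hL⟩ : QuotCell K L 0)

lemma quotProj_eq_iff {x y : K.X} : quotProj L x = quotProj L y ↔
    x = y ∨ (x ∈ (L : Set K.X) ∧ y ∈ (L : Set K.X)) := quotMk_eq_iff

lemma quotProj_eq {x y : K.X} (hx : x ∈ (L : Set K.X)) (hy : y ∈ (L : Set K.X)) :
    quotProj L x = quotProj L y := quotProj_eq_iff.2 (Or.inr ⟨hx, hy⟩)

lemma continuous_quotProj : Continuous (quotProj L) := K.continuous_quotMk L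

lemma surjective_quotProj : Function.Surjective (quotProj L) :=
  (K.isQuotientMap_quotMk L).surjective

lemma quotProj_mem_image_iff {A : Set K.X} {x : K.X} (hx : x ∉ (L : Set K.X)) :
    quotProj L x ∈ quotProj L '' A ↔ x ∈ A := by
  constructor
  · rintro ⟨y, hy, h⟩
    rcases quotProj_eq_iff.1 h with rfl | h
    · exact hy
    · exact absurd h.2 hx
  · exact mem_image_of_mem _

lemma openCell_quotCell {n : ℕ} (i : K.Cell n) (hi : i ∉ L.I n) :
    (K.quotient L).openCell n (quotCell i hi) = quotProj L '' K.openCell n i := by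
  change (fun y => quotProj L (RelCWComplex.map (C := (univ : Set K.X)) n i y)) '' ball 0 1 =
    quotProj L '' (RelCWComplex.map (C := (univ : Set K.X)) n i '' ball 0 1)
  rw [image_image]

lemma openCell_quotPoint (hL : (L : Set K.X).Nonempty) {x : K.X} (hx : x ∈ (L : Set K.X)) :
    (K.quotient L).openCell 0 (quotPoint hL) = {quotProj L x} := by
  have h : (fun _ : Fin 0 → ℝ => quotProj L hL.some) = fun _ => quotProj L x :=
    funext fun _ => quotProj_eq hL.some_mem hx
  change (fun _ : Fin 0 → ℝ => quotProj L hL.some) '' ball 0 1 = _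
  rw [h]
  exact (nonempty_ball.2 one_pos).image_const _

lemma quotient_cell_cases {motive : ∀ n, (K.quotient L).Cell n → Prop}
    (h_cell : ∀ n (i : K.Cell n) (hi : i ∉ L.I n), motive n (quotCell i hi))
    (h_point : ∀ hL : (L : Set K.X).Nonempty, motive 0 (quotPoint hL))
    (n : ℕ) (i : (K.quotient L).Cell n) : motive n i := by
  have h : ∀ i : QuotCell K L n, motive n i := by
    rintro (i | ⟨_, rfl, hL⟩)
    · exact h_cell n i.1 i.2
    · exact h_point hL
  exact h i

lemma isEmbedding_quotProj_compl :
    IsEmbedding ((L : Set K.X)ᶜ.domRestrict (quotProj L)) := by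
  have hc : Continuous ((L : Set K.X)ᶜ.domRestrict (K.quotMk L)) :=
    (K.continuous_quotMk L).comp continuous_subtype_val
  have hm : ∀ x : ((L : Set K.X)ᶜ : Set K.X), K.quotMk L x ∈ K.quotMk L '' (L : Set K.X)ᶜ :=
    fun x => mem_image_of_mem _ x.2
  have h : IsEmbedding (codRestrict ((L : Set K.X)ᶜ.domRestrict (K.quotMk L)) _ hm) := by
    refine IsEmbedding.of_comp (hc.codRestrict hm)
      (continuousOn_iff_continuous_domRestrict.1 continuousOn_quotOut) ?_
    convert! IsEmbedding.subtypeVal using 1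
    ext1 x
    exact quotOut_mk x.2
  exact IsEmbedding.subtypeVal.comp h

lemma IsCharMap.quotProj_comp {n : ℕ} {i : K.Cell n} {ψ : (Fin n → ℝ) → K.X}
    (hψ : K.IsCharMap n i ψ) (hi : i ∉ L.I n) :
    (K.quotient L).IsCharMap n (quotCell i hi) (fun y => quotProj L (ψ y)) where
  continuousOn := continuous_quotProj.comp_continuousOn hψ.continuousOn
  isEmbedding := by
    have hm : ∀ y : ball (0 : Fin n → ℝ) 1,
        (ball (0 : Fin n → ℝ) 1).domRestrict ψ y ∈ (L : Set K.X)ᶜ :=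
      fun y => notMem_of_mem_openCell hi (hψ.mem_openCell y.2)
    exact isEmbedding_quotProj_compl.comp (hψ.isEmbedding.codRestrict _ hm)
  image_ball := by
    rw [openCell_quotCell, ← hψ.image_ball, image_image]
  mapsTo_sphere := fun y hy => by
    obtain ⟨m, hm, j, hj⟩ := mem_skeletonLT.1 (hψ.mapsTo_sphere hy)
    rw [mem_skeletonLT]
    by_cases h : j ∈ L.I m
    · have hL := Sub.mem_I_iff.1 h hj
      have hne : (L : Set K.X).Nonempty := ⟨_, hL⟩
      refine ⟨0, by omega, quotPoint hne, ?_⟩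
      rw [openCell_quotPoint hne hL]
      rfl
    · refine ⟨m, hm, quotCell j h, ?_⟩
      rw [openCell_quotCell]
      exact mem_image_of_mem _ hj

/-- The image in `K/L` of a subcomplex of `K`. -/
noncomputable def Sub.quot (L A : K.Sub) : (K.quotient L).Sub :=
  Sub.ofCellular (quotProj L '' A)
    (((sub_closed A).isCompact.image continuous_quotProj).isClosed)
    (quotient_cell_cases
      (fun n i hi x hx hxA => by
        rw [openCell_quotCell] at hx ⊢
        obtain ⟨z, hz, rfl⟩ := hx
        rw [quotProj_mem_image_iff (notMem_of_mem_openCell hi hz)] at hxA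
        exact image_mono (Sub.openCell_subset_of_mem hz hxA))
      (fun hL x hx hxA => by
        rw [openCell_quotPoint hL hL.some_mem] at hx ⊢
        rw [singleton_subset_iff, ← mem_singleton_iff.1 hx]
        exact hxA))

@[simp]
lemma Sub.coe_quot (L A : K.Sub) : (Sub.quot L A : Set (K.quotient L).X) = quotProj L '' A := rfl

/-- An elementary collapse that removes no cell of `L` descends to the quotient by `L`. -/
lemma ElemCollapse.quot {E F : K.Sub} (h : ElemCollapse E F)
    (hL : (E : Set K.X) ∩ L ⊆ F) : ElemCollapse (Sub.quot L E) (Sub.quot L F) := by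
  obtain ⟨m, a, b, ha, hb, hE, ψ, hψ, hψa, hm⟩ := elemCollapse_iff.1 h
  have hcell : ∀ {n : ℕ} {c : K.Cell n}, K.openCell n c ⊆ E → c ∉ F.I n → c ∉ L.I n := by
    intro n c hcE hcF hcL
    obtain ⟨x, hx⟩ := RelCWComplex.openCell_nonempty (C := (univ : Set K.X)) n c
    exact notMem_of_mem_openCell hcF hx (hL ⟨hcE hx, Sub.mem_I_iff.1 hcL hx⟩)
  have haL : a ∉ L.I m := hcell (hE ▸ subset_union_right.trans subset_union_left) ha
  have hbL : b ∉ L.I (m + 1) := hcell (hE ▸ subset_union_right) hb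
  have hnot : ∀ {n : ℕ} {c : K.Cell n} (hcL : c ∉ L.I n), c ∉ F.I n →
      quotCell c hcL ∉ (Sub.quot L F).I n := by
    intro n c hcL hcF
    obtain ⟨x, hx⟩ := RelCWComplex.openCell_nonempty (C := (univ : Set K.X)) n c
    have hx' : quotProj L x ∈ (K.quotient L).openCell n (quotCell c hcL) := by
      rw [openCell_quotCell]
      exact mem_image_of_mem _ hx
    refine Sub.notMem_I_of_notMem hx' ?_
    rw [Sub.coe_quot, quotProj_mem_image_iff (notMem_of_mem_openCell hcL hx)]
    exact notMem_of_mem_openCell hcF hx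
  refine elemCollapse_iff.2 ⟨m, quotCell a haL, quotCell b hbL, hnot haL ha, hnot hbL hb, ?_,
    fun y => quotProj L (ψ y), hψ.quotProj_comp hbL, hψa.quotProj_comp haL,
    fun y hy hlast h => ?_⟩
  · rw [openCell_quotCell, openCell_quotCell, Sub.coe_quot, Sub.coe_quot, hE, image_union,
      image_union]
  · rw [openCell_quotCell] at h
    obtain ⟨x, hx, h⟩ := h
    rcases quotProj_eq_iff.1 h with h | h
    · exact hm y hy hlast (h ▸ hx)
    · exact notMem_of_mem_openCell haL hx h.1

lemma DimLE.quotient {n : ℕ} (h : K.DimLE n) (L : K.Sub) : (K.quotient L).DimLE n := by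
  refine fun m hm => ⟨fun i => ?_⟩
  revert hm
  refine quotient_cell_cases (motive := fun m _ => n < m → False) ?_ ?_ m i
  · exact fun m i _ hm => (h m hm).false i
  · exact fun _ hm => absurd hm (by omega)

end Quotient

/-! ### Reflections and transpositions of the cube -/

section CubeSymmetry

/-- A continuous involution of `ℝⁿ`, as a homeomorphism. -/
def involutionHomeomorph {n : ℕ} (σ : (Fin n → ℝ) → (Fin n → ℝ)) (hσ : Function.Involutive σ)
    (hc : Continuous σ) : (Fin n → ℝ) ≃ₜ (Fin n → ℝ) where
  toEquiv := hσ.toPerm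
  continuous_toFun := hc
  continuous_invFun := hc

lemma norm_eq_of_involutive {n : ℕ} {σ : (Fin n → ℝ) → (Fin n → ℝ)} (hσ : Function.Involutive σ)
    (h : ∀ y, ‖σ y‖ ≤ ‖y‖) (y : Fin n → ℝ) : ‖σ y‖ = ‖y‖ :=
  le_antisymm (h y) (by simpa only [hσ y] using h (σ y))

/-- Reflection of the last coordinate. -/
def flipLast {n : ℕ} (y : Fin (n + 1) → ℝ) : Fin (n + 1) → ℝ :=
  Fin.snoc (α := fun _ => ℝ) (Fin.init (α := fun _ => ℝ) y) (-y (Fin.last n))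

@[simp]
lemma init_flipLast {n : ℕ} (y : Fin (n + 1) → ℝ) :
    Fin.init (α := fun _ => ℝ) (flipLast y) = Fin.init (α := fun _ => ℝ) y :=
  Fin.init_snoc (α := fun _ => ℝ) _ _

@[simp]
lemma flipLast_last {n : ℕ} (y : Fin (n + 1) → ℝ) :
    flipLast y (Fin.last n) = -y (Fin.last n) := by
  simp [flipLast]

lemma involutive_flipLast {n : ℕ} : Function.Involutive (flipLast (n := n)) := by
  intro y
  rw [flipLast, init_flipLast, flipLast_last, neg_neg, Fin.snoc_init_self]

lemma continuous_flipLast {n : ℕ} : Continuous (flipLast (n := n)) :=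
  continuous_finInit.finSnoc (continuous_apply _).neg

lemma norm_flipLast {n : ℕ} (y : Fin (n + 1) → ℝ) : ‖flipLast y‖ = ‖y‖ := by
  refine norm_eq_of_involutive involutive_flipLast (fun y => ?_) y
  rw [pi_norm_le_iff_of_nonneg (norm_nonneg _), Fin.forall_fin_succ']
  refine ⟨fun j => ?_, ?_⟩
  · simpa [flipLast, Fin.init] using norm_le_pi_norm y j.castSucc
  · rw [flipLast_last, norm_neg]
    exact norm_le_pi_norm y _

/-- Transposition of the last two coordinates. -/
def swapLast {n : ℕ} (y : Fin (n + 2) → ℝ) : Fin (n + 2) → ℝ :=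
  y ∘ Equiv.swap (Fin.last (n + 1)) (Fin.last n).castSucc

lemma init_swapLast {n : ℕ} (y : Fin (n + 2) → ℝ) :
    Fin.init (α := fun _ => ℝ) (swapLast y) =
      Fin.snoc (α := fun _ => ℝ)
        (Fin.init (α := fun _ => ℝ) (Fin.init (α := fun _ => ℝ) y)) (y (Fin.last (n + 1))) := by
  ext j
  refine Fin.lastCases ?_ (fun j => ?_) j
  · simp [Fin.init, swapLast]
  · have h1 : j.castSucc.castSucc ≠ Fin.last (n + 1) := (Fin.castSucc_lt_last _).ne
    have h2 : j.castSucc.castSucc ≠ (Fin.last n).castSucc := fun h =>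
      (Fin.castSucc_lt_last j).ne (Fin.castSucc_injective _ h)
    simp [Fin.init, swapLast, Equiv.swap_apply_of_ne_of_ne h1 h2]

lemma swapLast_last {n : ℕ} (y : Fin (n + 2) → ℝ) :
    swapLast y (Fin.last (n + 1)) = y (Fin.last n).castSucc := by
  simp [swapLast]

lemma involutive_swapLast {n : ℕ} : Function.Involutive (swapLast (n := n)) := by
  intro y
  ext j
  simp [swapLast]

lemma continuous_swapLast {n : ℕ} : Continuous (swapLast (n := n)) :=
  continuous_pi fun _ => continuous_apply _

lemma norm_swapLast {n : ℕ} (y : Fin (n + 2) → ℝ) : ‖swapLast y‖ = ‖y‖ :=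
  norm_eq_of_involutive involutive_swapLast (fun y =>
    (pi_norm_le_iff_of_nonneg (norm_nonneg _)).2 fun _ => norm_le_pi_norm y _) y

end CubeSymmetry

/-! ### The cylinder -/

section Cylinder

/-- The endpoints of the interval `[-1, 1]`: `-1` for `false` and `1` for `true`. -/
def endpt : Bool → Icc (-1 : ℝ) 1
  | false => ⟨-1, by norm_num⟩
  | true => ⟨1, by norm_num⟩

lemma endpt_injective : Function.Injective endpt := by
  rintro (_ | _) (_ | _) h
  · rfl
  · exact absurd (congrArg Subtype.val h) (by norm_num [endpt])
  · exact absurd (congrArg Subtype.val h) (by norm_num [endpt])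
  · rfl

lemma endpt_false_ne_true : endpt false ≠ endpt true :=
  fun h => Bool.false_ne_true (endpt_injective h)

@[simp]
lemma abs_endpt (ε : Bool) : |(endpt ε : ℝ)| = 1 := by
  cases ε <;> simp [endpt]

lemma abs_lt_one_or_eq_endpt (t : Icc (-1 : ℝ) 1) : |(t : ℝ)| < 1 ∨ ∃ ε, t = endpt ε := by
  rcases (abs_le.2 t.2).lt_or_eq with h | h
  · exact Or.inl h
  · right
    rcases eq_or_eq_neg_of_abs_eq h with h | h
    · exact ⟨true, Subtype.ext h⟩
    · exact ⟨false, Subtype.ext h⟩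

/-- The retraction of `ℝ` onto `[-1, 1]`. -/
noncomputable def clamp : ℝ → Icc (-1 : ℝ) 1 := projIcc (-1) 1 (by norm_num)

lemma continuous_clamp : Continuous clamp := continuous_projIcc

lemma coe_clamp {t : ℝ} (ht : |t| ≤ 1) : (clamp t : ℝ) = t :=
  congrArg Subtype.val (projIcc_of_mem _ (abs_le.1 ht))

variable (K : FiniteCW.{u})

/-- The cells of `K × [-1, 1]`: for every cell `e` of `K` its copies at the two ends, of the same
dimension, and `e × (-1, 1)`, of one dimension more. -/
inductive CylCell : ℕ → Type u
  | ends {n : ℕ} (i : K.Cell n) (ε : Bool) : CylCell n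
  | inner {n : ℕ} (i : K.Cell n) : CylCell (n + 1)

variable {K}

/-- A map `ψ` of the cube into `K`, as a map into one end of `K × [-1, 1]`. -/
def endsMap {n : ℕ} (ψ : (Fin n → ℝ) → K.X) (ε : Bool) (y : Fin n → ℝ) :
    K.X × Icc (-1 : ℝ) 1 :=
  (ψ y, endpt ε)

/-- The product of a map `ψ` of the cube into `K` with the interval. -/
noncomputable def innerMap {n : ℕ} (ψ : (Fin n → ℝ) → K.X) (y : Fin (n + 1) → ℝ) :
    K.X × Icc (-1 : ℝ) 1 :=
  (ψ (Fin.init (α := fun _ => ℝ) y), clamp (y (Fin.last n)))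

/-- The open cells of `K × [-1, 1]`. -/
def cylOpen : ∀ {n : ℕ}, K.CylCell n → Set (K.X × Icc (-1 : ℝ) 1)
  | _, .ends (n := n) i ε => {p | p.1 ∈ K.openCell n i ∧ p.2 = endpt ε}
  | _, .inner (n := n) i => {p | p.1 ∈ K.openCell n i ∧ |(p.2 : ℝ)| < 1}

/-- The characteristic maps of `K × [-1, 1]`. -/
noncomputable def cylMap : ∀ {n : ℕ}, K.CylCell n → (Fin n → ℝ) → K.X × Icc (-1 : ℝ) 1
  | _, .ends (n := n) i ε => endsMap (RelCWComplex.map (C := (univ : Set K.X)) n i) ε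
  | _, .inner (n := n) i => innerMap (RelCWComplex.map (C := (univ : Set K.X)) n i)

lemma mem_cylOpen_inner_or_ends {n : ℕ} {j : K.Cell n} {p : K.X × Icc (-1 : ℝ) 1}
    (hp : p.1 ∈ K.openCell n j) : (|(p.2 : ℝ)| < 1 ∧ p ∈ cylOpen (.inner j)) ∨
      ∃ ε, p.2 = endpt ε ∧ p ∈ cylOpen (.ends j ε) := by
  rcases abs_lt_one_or_eq_endpt p.2 with h | ⟨ε, h⟩
  · exact Or.inl ⟨h, hp, h⟩
  · exact Or.inr ⟨ε, h, hp, h⟩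

namespace IsCharMap

variable {n : ℕ} {i : K.Cell n} {ψ : (Fin n → ℝ) → K.X}

lemma continuousOn_endsMap (h : K.IsCharMap n i ψ) (ε : Bool) :
    ContinuousOn (endsMap ψ ε) (closedBall 0 1) :=
  h.continuousOn.prodMk continuousOn_const

lemma continuousOn_innerMap (h : K.IsCharMap n i ψ) :
    ContinuousOn (innerMap ψ) (closedBall 0 1) :=
  (h.continuousOn.comp continuous_finInit.continuousOn
    fun _ hy => (mem_closedBall_iff_init_last.1 hy).1).prodMk
    (continuous_clamp.comp (continuous_apply _)).continuousOn

lemma isEmbedding_endsMap (h : K.IsCharMap n i ψ) (ε : Bool) :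
    IsEmbedding ((ball (0 : Fin n → ℝ) 1).domRestrict (endsMap ψ ε)) :=
  IsEmbedding.of_comp (continuousOn_iff_continuous_domRestrict.1
    ((h.continuousOn_endsMap ε).mono ball_subset_closedBall)) continuous_fst h.isEmbedding

lemma isEmbedding_innerMap (h : K.IsCharMap n i ψ) :
    IsEmbedding ((ball (0 : Fin (n + 1) → ℝ) 1).domRestrict (innerMap ψ)) := by
  -- `innerMap ψ` is the composition of the splitting of the cube with a product of embeddings
  let split : ball (0 : Fin (n + 1) → ℝ) 1 → ball (0 : Fin n → ℝ) 1 × Ioo (-1 : ℝ) 1 := fun y =>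
    (⟨_, (mem_ball_iff_init_last.1 y.2).1⟩, ⟨_, abs_lt.1 (mem_ball_iff_init_last.1 y.2).2⟩)
  have h_split : IsEmbedding split := by
    refine IsEmbedding.of_comp (g := fun p => Fin.snoc (α := fun _ => ℝ) p.1.1 p.2.1) ?_ ?_ ?_
    · exact Continuous.prodMk
        (Continuous.subtype_mk (continuous_finInit.comp continuous_subtype_val) _)
        (Continuous.subtype_mk ((continuous_apply _).comp continuous_subtype_val) _)
    · have h1 : Continuous fun p : ball (0 : Fin n → ℝ) 1 × Ioo (-1 : ℝ) 1 => p.1.1 :=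
        continuous_subtype_val.comp continuous_fst
      have h2 : Continuous fun p : ball (0 : Fin n → ℝ) 1 × Ioo (-1 : ℝ) 1 => p.2.1 :=
        continuous_subtype_val.comp continuous_snd
      exact h1.finSnoc h2
    · convert! IsEmbedding.subtypeVal using 1
      ext1 y
      exact Fin.snoc_init_self (α := fun _ => ℝ) y.1
  have h_clamp : IsEmbedding (fun t : Ioo (-1 : ℝ) 1 => clamp t) := by
    rw [← IsEmbedding.subtypeVal.of_comp_iff]
    convert! IsEmbedding.subtypeVal using 1
    ext1 t
    exact coe_clamp (abs_lt.2 t.2).le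
  exact (h.isEmbedding.prodMap h_clamp).comp h_split

lemma image_endsMap (h : K.IsCharMap n i ψ) (ε : Bool) :
    endsMap ψ ε '' ball 0 1 = cylOpen (.ends i ε) := by
  ext ⟨x, t⟩
  constructor
  · rintro ⟨y, hy, hyx⟩
    rw [← hyx]
    exact ⟨h.mem_openCell hy, rfl⟩
  · rintro ⟨hx, ht⟩
    rw [← h.image_ball] at hx
    obtain ⟨y, hy, hyx⟩ := hx
    exact ⟨y, hy, Prod.ext hyx ht.symm⟩

lemma image_innerMap (h : K.IsCharMap n i ψ) :
    innerMap ψ '' ball 0 1 = cylOpen (.inner i) := by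
  ext ⟨x, t⟩
  constructor
  · rintro ⟨y, hy, hyx⟩
    rw [← hyx]
    rw [mem_ball_iff_init_last] at hy
    refine ⟨h.mem_openCell hy.1, ?_⟩
    change |(clamp _ : ℝ)| < 1
    rw [coe_clamp hy.2.le]
    exact hy.2
  · rintro ⟨hx, ht⟩
    rw [← h.image_ball] at hx
    obtain ⟨y, hy, hyx⟩ := hx
    refine ⟨Fin.snoc (α := fun _ => ℝ) y t, ?_, Prod.ext ?_ (Subtype.ext ?_)⟩
    · rw [mem_ball_iff_init_last]
      simpa using And.intro (by simpa using hy) ht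
    · simpa [innerMap] using hyx
    · simpa [innerMap] using coe_clamp ht.le

lemma exists_mem_openCell_of_closedBall (h : K.IsCharMap n i ψ) {y : Fin n → ℝ}
    (hy : y ∈ closedBall (0 : Fin n → ℝ) 1) : ∃ m ≤ n, ∃ j : K.Cell m, ψ y ∈ K.openCell m j := by
  by_cases hb : y ∈ ball (0 : Fin n → ℝ) 1
  · exact ⟨n, le_rfl, i, h.mem_openCell hb⟩
  · obtain ⟨m, hm, hj⟩ := mem_skeletonLT.1
      (h.mapsTo_sphere (mem_sphere_iff_closedBall_ball.2 ⟨hy, hb⟩))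
    exact ⟨m, hm.le, hj⟩

lemma endsMap_sphere (h : K.IsCharMap n i ψ) (ε : Bool) {y : Fin n → ℝ}
    (hy : y ∈ sphere (0 : Fin n → ℝ) 1) :
    ∃ m < n, ∃ c : K.CylCell m, endsMap ψ ε y ∈ cylOpen c := by
  obtain ⟨m, hm, j, hj⟩ := mem_skeletonLT.1 (h.mapsTo_sphere hy)
  exact ⟨m, hm, .ends j ε, hj, rfl⟩

lemma innerMap_sphere (h : K.IsCharMap n i ψ) {y : Fin (n + 1) → ℝ}
    (hy : y ∈ sphere (0 : Fin (n + 1) → ℝ) 1) :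
    ∃ m < n + 1, ∃ c : K.CylCell m, innerMap ψ y ∈ cylOpen c := by
  obtain ⟨⟨h1, h2⟩, h3⟩ := mem_sphere_iff_init_last.1 hy
  rcases h3 with h3 | h3
  · obtain ⟨m, hm, j, hj⟩ := mem_skeletonLT.1 (h.mapsTo_sphere h3)
    rcases mem_cylOpen_inner_or_ends (p := innerMap ψ y) hj with ⟨-, h'⟩ | ⟨ε, -, h'⟩
    · exact ⟨m + 1, by omega, _, h'⟩
    · exact ⟨m, by omega, _, h'⟩
  · obtain ⟨m, hm, j, hj⟩ := h.exists_mem_openCell_of_closedBall h1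
    rcases mem_cylOpen_inner_or_ends (p := innerMap ψ y) hj with ⟨h', -⟩ | ⟨ε, -, h'⟩
    · change |(clamp _ : ℝ)| < 1 at h'
      rw [coe_clamp h2, h3] at h'
      exact absurd h' (lt_irrefl _)
    · exact ⟨m, by omega, _, h'⟩

end IsCharMap

lemma image_cylMap {n : ℕ} (c : K.CylCell n) : cylMap c '' ball 0 1 = cylOpen c := by
  cases c with
  | ends i ε => exact (isCharMap_map _ i).image_endsMap ε
  | inner i => exact (isCharMap_map _ i).image_innerMap

lemma cylCell_eq_of_mem {n m : ℕ} {c : K.CylCell n} {d : K.CylCell m}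
    {p : K.X × Icc (-1 : ℝ) 1} (hc : p ∈ cylOpen c) (hd : p ∈ cylOpen d) :
    (⟨n, c⟩ : Σ n, K.CylCell n) = ⟨m, d⟩ := by
  cases c with
  | ends i ε =>
    cases d with
    | ends j δ =>
      obtain ⟨rfl, h⟩ := Sigma.mk.inj_iff.1 (cell_eq_of_mem hc.1 hd.1)
      rw [eq_of_heq h, endpt_injective (hc.2.symm.trans hd.2)]
    | inner j =>
      have h := hd.2
      rw [hc.2, abs_endpt] at h
      exact absurd h (lt_irrefl _)
  | inner i =>
    cases d with
    | ends j δ =>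
      have h := hc.2
      rw [hd.2, abs_endpt] at h
      exact absurd h (lt_irrefl _)
    | inner j =>
      obtain ⟨h1, h⟩ := Sigma.mk.inj_iff.1 (cell_eq_of_mem hc.1 hd.1)
      subst h1
      rw [eq_of_heq h]

lemma finite_cylCell (n : ℕ) : Finite (K.CylCell n) := by
  have h1 := K.finite_cell n
  cases n with
  | zero =>
    refine Finite.of_surjective (fun p : K.Cell 0 × Bool => CylCell.ends p.1 p.2) ?_
    rintro ⟨i, ε⟩
    exact ⟨(i, ε), rfl⟩
  | succ n =>
    have h2 := K.finite_cell n
    refine Finite.of_surjective (fun p : (K.Cell (n + 1) × Bool) ⊕ K.Cell n =>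
      Sum.elim (fun p => CylCell.ends p.1 p.2) (fun i => CylCell.inner i) p) ?_
    rintro (⟨i, ε⟩ | i)
    · exact ⟨Sum.inl (i, ε), rfl⟩
    · exact ⟨Sum.inr i, rfl⟩

lemma cylCell_eventually_isEmpty : ∀ᶠ n in Filter.atTop, IsEmpty (K.CylCell n) := by
  have h := K.eventually_isEmpty_cell
  filter_upwards [h, (Filter.tendsto_sub_atTop_nat 1).eventually h] with n h1 h2
  constructor
  rintro (⟨i, ε⟩ | i)
  · exact h1.false i
  · exact h2.false i

variable (K)

/-- The cylinder `K × [-1, 1]`. -/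
noncomputable def cyl : FiniteCW.{u} :=
  ofCharMaps (K.X × Icc (-1 : ℝ) 1) K.CylCell (fun _ => cylMap) cylCell_eventually_isEmpty
    finite_cylCell
    (fun n c => by
      cases c with
      | ends i ε => exact (isCharMap_map _ i).continuousOn_endsMap ε
      | inner i => exact (isCharMap_map _ i).continuousOn_innerMap)
    (fun n c => by
      cases c with
      | ends i ε => exact (isCharMap_map _ i).isEmbedding_endsMap ε
      | inner i => exact (isCharMap_map _ i).isEmbedding_innerMap)
    (fun n c m d y hy z hz h =>
      cylCell_eq_of_mem (image_cylMap c ▸ mem_image_of_mem _ hy)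
        (h ▸ image_cylMap d ▸ mem_image_of_mem _ hz))
    (fun n c y hy => by
      simp only [image_cylMap]
      cases c with
      | ends i ε => exact (isCharMap_map _ i).endsMap_sphere ε hy
      | inner i => exact (isCharMap_map _ i).innerMap_sphere hy)
    (fun p => by
      simp only [image_cylMap]
      obtain ⟨n, i, hi⟩ := exists_mem_openCell p.1
      rcases mem_cylOpen_inner_or_ends hi with ⟨-, h⟩ | ⟨ε, -, h⟩
      · exact ⟨_, _, h⟩
      · exact ⟨_, _, h⟩)

variable {K}

/-- The cell `e × {±1}` of the cylinder. -/
def cylEnd {n : ℕ} (i : K.Cell n) (ε : Bool) : K.cyl.Cell n := CylCell.ends i ε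

/-- The cell `e × (-1, 1)` of the cylinder. -/
def cylInner {n : ℕ} (i : K.Cell n) : K.cyl.Cell (n + 1) := CylCell.inner i

/-- The point `(x, t)` of the cylinder, whose underlying type is the product `K.X × [-1, 1]`. -/
def cylMk (x : K.X) (t : Icc (-1 : ℝ) 1) : K.cyl.X := (x, t)

/-- The projection of the cylinder to its base. -/
def cylFst (p : K.cyl.X) : K.X := Prod.fst (β := Icc (-1 : ℝ) 1) p

/-- The projection of the cylinder to the interval. -/
def cylSnd (p : K.cyl.X) : Icc (-1 : ℝ) 1 := Prod.snd (α := K.X) p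

@[simp]
lemma cylFst_cylMk (x : K.X) (t : Icc (-1 : ℝ) 1) : cylFst (cylMk x t) = x := rfl

@[simp]
lemma cylSnd_cylMk (x : K.X) (t : Icc (-1 : ℝ) 1) : cylSnd (cylMk x t) = t := rfl

@[simp]
lemma cylMk_eta (p : K.cyl.X) : cylMk (cylFst p) (cylSnd p) = p := rfl

lemma continuous_cylMk_left (t : Icc (-1 : ℝ) 1) : Continuous (fun x : K.X => cylMk x t) :=
  Continuous.prodMk_left t

lemma continuous_cylFst : Continuous (cylFst (K := K)) := continuous_fst

lemma continuous_cylSnd : Continuous (cylSnd (K := K)) := continuous_snd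

lemma openCell_cyl {n : ℕ} (c : K.CylCell n) : K.cyl.openCell n c = cylOpen c :=
  image_cylMap c

lemma mem_openCell_cylEnd {n : ℕ} {i : K.Cell n} {ε : Bool} {p : K.cyl.X} :
    p ∈ K.cyl.openCell n (cylEnd i ε) ↔ cylFst p ∈ K.openCell n i ∧ cylSnd p = endpt ε := by
  rw [cylEnd, openCell_cyl]
  rfl

lemma mem_openCell_cylInner {n : ℕ} {i : K.Cell n} {p : K.cyl.X} :
    p ∈ K.cyl.openCell (n + 1) (cylInner i) ↔
      cylFst p ∈ K.openCell n i ∧ |(cylSnd p : ℝ)| < 1 := by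
  rw [cylInner, openCell_cyl]
  rfl

lemma cyl_cell_cases {motive : ∀ n, K.cyl.Cell n → Prop}
    (h_end : ∀ n (i : K.Cell n) ε, motive n (cylEnd i ε))
    (h_inner : ∀ n (i : K.Cell n), motive (n + 1) (cylInner i))
    (n : ℕ) (c : K.cyl.Cell n) : motive n c := by
  have h : ∀ c : K.CylCell n, motive n c := fun c => by
    cases c with
    | ends i ε => exact h_end _ i ε
    | inner i => exact h_inner _ i
  exact h c

namespace IsCharMap

variable {n : ℕ} {i : K.Cell n} {ψ : (Fin n → ℝ) → K.X}

lemma cylEnd (h : K.IsCharMap n i ψ) (ε : Bool) :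
    K.cyl.IsCharMap n (cylEnd i ε) (fun y => cylMk (ψ y) (endpt ε)) where
  continuousOn := h.continuousOn_endsMap ε
  isEmbedding := h.isEmbedding_endsMap ε
  image_ball := (h.image_endsMap ε).trans (openCell_cyl _).symm
  mapsTo_sphere := fun y hy => by
    rw [mem_skeletonLT]
    obtain ⟨m, hm, c, hc⟩ := h.endsMap_sphere ε hy
    exact ⟨m, hm, c, (openCell_cyl c).symm ▸ hc⟩

lemma cylInner (h : K.IsCharMap n i ψ) :
    K.cyl.IsCharMap (n + 1) (cylInner i)
      (fun y => cylMk (ψ (Fin.init (α := fun _ => ℝ) y)) (clamp (y (Fin.last n)))) where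
  continuousOn := h.continuousOn_innerMap
  isEmbedding := h.isEmbedding_innerMap
  image_ball := h.image_innerMap.trans (openCell_cyl _).symm
  mapsTo_sphere := fun y hy => by
    rw [mem_skeletonLT]
    obtain ⟨m, hm, c, hc⟩ := h.innerMap_sphere hy
    exact ⟨m, hm, c, (openCell_cyl c).symm ▸ hc⟩

end IsCharMap

lemma DimLE.cyl {n : ℕ} (h : K.DimLE n) : K.cyl.DimLE (n + 1) := by
  refine fun m hm => ⟨fun c => ?_⟩
  revert hm
  refine cyl_cell_cases (motive := fun m _ => n + 1 < m → False) ?_ ?_ m c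
  · exact fun m i _ hm => (h m (by omega)).false i
  · exact fun m i hm => (h m (by omega)).false i

/-! ### Collapses of the cylinder -/

/-- The subcomplex `K × {ε} ∪ S × [-1, 1] ∪ A × {-ε}` of the cylinder, where `ε` is one of the
ends and `-ε` the other. -/
noncomputable def slab (ε : Bool) (A S : K.Sub) : K.cyl.Sub :=
  Sub.ofCellular
    {p | cylSnd p = endpt ε ∨ cylFst p ∈ (S : Set K.X) ∨
      (cylFst p ∈ (A : Set K.X) ∧ cylSnd p = endpt !ε)}
    ((isClosed_singleton.preimage continuous_cylSnd).union
      (((sub_closed S).preimage continuous_cylFst).union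
        (((sub_closed A).preimage continuous_cylFst).inter
          (isClosed_singleton.preimage continuous_cylSnd))))
    (cyl_cell_cases
      (fun n i δ p hp hpA q hq => by
        rw [mem_openCell_cylEnd] at hp hq
        rcases hpA with h | h | ⟨h, h'⟩
        · exact Or.inl (hq.2.trans (hp.2.symm.trans h))
        · exact Or.inr (Or.inl (Sub.openCell_subset_of_mem hp.1 h hq.1))
        · exact Or.inr (Or.inr ⟨Sub.openCell_subset_of_mem hp.1 h hq.1,
            hq.2.trans (hp.2.symm.trans h')⟩))
      (fun n i p hp hpA q hq => by
        rw [mem_openCell_cylInner] at hp hq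
        have hne : ∀ δ, cylSnd p ≠ endpt δ := fun δ h => by
          have := hp.2
          rw [h, abs_endpt] at this
          exact lt_irrefl _ this
        rcases hpA with h | h | ⟨h, h'⟩
        · exact absurd h (hne _)
        · exact Or.inr (Or.inl (Sub.openCell_subset_of_mem hp.1 h hq.1))
        · exact absurd h' (hne _)))

lemma mem_slab {ε : Bool} {A S : K.Sub} {p : K.cyl.X} : p ∈ (slab ε A S : Set K.cyl.X) ↔
    cylSnd p = endpt ε ∨ cylFst p ∈ (S : Set K.X) ∨
      (cylFst p ∈ (A : Set K.X) ∧ cylSnd p = endpt !ε) := Iff.rfl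

lemma cylInner_notMem_slab {ε : Bool} {A S : K.Sub} {n : ℕ} {i : K.Cell n} (hi : i ∉ S.I n) :
    cylInner i ∉ (slab ε A S).I (n + 1) := by
  obtain ⟨x, hx⟩ := RelCWComplex.openCell_nonempty (C := (univ : Set K.X)) n i
  have h0 : |((⟨0, by norm_num⟩ : Icc (-1 : ℝ) 1) : ℝ)| < 1 := by simp
  refine Sub.notMem_I_of_notMem (x := cylMk x ⟨0, by norm_num⟩)
    (mem_openCell_cylInner.2 ⟨hx, h0⟩) ?_
  have hne : ∀ δ, (⟨0, by norm_num⟩ : Icc (-1 : ℝ) 1) ≠ endpt δ := fun δ h => by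
    rw [h, abs_endpt] at h0
    exact lt_irrefl _ h0
  rw [mem_slab]
  rintro (h | h | ⟨-, h⟩)
  · exact hne _ h
  · exact notMem_of_mem_openCell hi hx h
  · exact hne _ h

lemma clamp_ne_endpt_not {ε : Bool} {t : ℝ} (ht : |t| ≤ 1) (h : t ≠ 1) :
    clamp (bif ε then -t else t) ≠ endpt !ε := by
  intro h'
  have h'' := congrArg Subtype.val h'
  cases ε
  · simp only [cond_false, coe_clamp ht, endpt, Bool.not_false] at h''
    exact h h''
  · simp only [cond_true, endpt, Bool.not_true] at h''
    rw [coe_clamp (by rwa [abs_neg])] at h''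
    exact h (neg_injective h'')

lemma clamp_one (ε : Bool) : clamp (bif ε then -1 else 1) = endpt !ε := by
  apply Subtype.ext
  rw [coe_clamp] <;> cases ε <;> simp [endpt]

/-- A cell `e` of `S` outside `A` that is not needed by the other cells of `S` can be removed from
`S`: its copy at the end `-ε` is a free face of `e × [-1, 1]`. -/
lemma elemCollapse_slab_of_cell (ε : Bool) {A S S' : K.Sub} {n : ℕ} {i : K.Cell n}
    (hS : (S : Set K.X) = (S' : Set K.X) ∪ K.openCell n i) (hi : i ∉ S'.I n) (hA : i ∉ A.I n) :
    ElemCollapse (slab ε A S) (slab ε A S') := by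
  have hψ := isCharMap_map n i
  -- the reflection brings the free face to the end `-ε`
  have hchar : K.cyl.IsCharMap (n + 1) (cylInner i) (fun y => cylMk
      (RelCWComplex.map (C := (univ : Set K.X)) n i (Fin.init (α := fun _ => ℝ) y))
      (clamp (bif ε then -y (Fin.last n) else y (Fin.last n)))) := by
    cases ε
    · exact hψ.cylInner
    · convert! hψ.cylInner.comp_homeomorph
        (involutionHomeomorph flipLast involutive_flipLast continuous_flipLast)
        norm_flipLast using 1
      ext1 y
      change _ = cylMk (RelCWComplex.map (C := (univ : Set K.X)) n i
        (Fin.init (α := fun _ => ℝ) (flipLast y))) (clamp (flipLast y (Fin.last n)))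
      rw [init_flipLast, flipLast_last]
      rfl
  refine elemCollapse_iff.2 ⟨n, cylEnd i !ε, cylInner i, ?_, cylInner_notMem_slab hi, ?_, _,
    hchar, ?_, fun y hy hlast h => ?_⟩
  · obtain ⟨x, hx⟩ := RelCWComplex.openCell_nonempty (C := (univ : Set K.X)) n i
    refine Sub.notMem_I_of_notMem (x := cylMk x (endpt !ε)) (mem_openCell_cylEnd.2 ⟨hx, rfl⟩) ?_
    rw [mem_slab]
    rintro (h | h | ⟨h, -⟩)
    · exact absurd (endpt_injective h) (by simp)
    · exact notMem_of_mem_openCell hi hx h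
    · exact notMem_of_mem_openCell hA hx h
  · ext p
    rw [mem_union, mem_union, mem_slab, mem_slab, mem_openCell_cylEnd, mem_openCell_cylInner, hS,
      mem_union]
    constructor
    · rintro (h | (h | h) | h)
      · exact Or.inl (Or.inl (Or.inl h))
      · exact Or.inl (Or.inl (Or.inr (Or.inl h)))
      · rcases abs_lt_one_or_eq_endpt (cylSnd p) with h' | ⟨δ, h'⟩
        · exact Or.inr ⟨h, h'⟩
        · rcases Bool.eq_or_eq_not δ ε with rfl | rfl
          · exact Or.inl (Or.inl (Or.inl h'))
          · exact Or.inl (Or.inr ⟨h, h'⟩)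
      · exact Or.inl (Or.inl (Or.inr (Or.inr h)))
    · rintro (((h | h | h) | h) | h)
      · exact Or.inl h
      · exact Or.inr (Or.inl (Or.inl h))
      · exact Or.inr (Or.inr h)
      · exact Or.inr (Or.inl (Or.inr h.1))
      · exact Or.inr (Or.inl (Or.inr h.1))
  · convert! hψ.cylEnd (!ε) using 1
    ext1 y
    simp [clamp_one]
  · exact clamp_ne_endpt_not (mem_sphere_iff_init_last.1 hy).1.2 hlast
      (mem_openCell_cylEnd.1 h).2

/-- An elementary collapse of `S` within `A` gives one of the slabs: if `a` is a free face of `b`,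
then `a × (-1, 1)` is one of `b × (-1, 1)`. -/
lemma elemCollapse_slab_of_elemCollapse (ε : Bool) {A S S' : K.Sub} (h : ElemCollapse S S')
    (hA : (S : Set K.X) ⊆ A) : ElemCollapse (slab ε A S) (slab ε A S') := by
  obtain ⟨m, a, b, ha, hb, hS, ψ, hψ, hψa, hm⟩ := elemCollapse_iff.1 h
  -- the transposition makes the coordinate of the free face of `b` the last one
  have hchar := hψ.cylInner.comp_homeomorph
    (involutionHomeomorph swapLast involutive_swapLast continuous_swapLast) norm_swapLast
  refine elemCollapse_iff.2 ⟨m + 1, cylInner a, cylInner b, cylInner_notMem_slab ha,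
    cylInner_notMem_slab hb, ?_, _, hchar, ?_, fun y hy hlast h' => ?_⟩
  · ext p
    rw [mem_union, mem_union, mem_slab, mem_slab, mem_openCell_cylInner, mem_openCell_cylInner]
    constructor
    · rintro (h | h | h)
      · exact Or.inl (Or.inl (Or.inl h))
      · rcases abs_lt_one_or_eq_endpt (cylSnd p) with h' | ⟨δ, h'⟩
        · rw [hS] at h
          rcases h with (h | h) | h
          · exact Or.inl (Or.inl (Or.inr (Or.inl h)))
          · exact Or.inl (Or.inr ⟨h, h'⟩)
          · exact Or.inr ⟨h, h'⟩
        · rcases Bool.eq_or_eq_not δ ε with rfl | rfl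
          · exact Or.inl (Or.inl (Or.inl h'))
          · exact Or.inl (Or.inl (Or.inr (Or.inr ⟨hA h, h'⟩)))
      · exact Or.inl (Or.inl (Or.inr (Or.inr h)))
    · rw [hS]
      rintro (((h | h | h) | h) | h)
      · exact Or.inl h
      · exact Or.inr (Or.inl (Or.inl (Or.inl h)))
      · exact Or.inr (Or.inr h)
      · exact Or.inr (Or.inl (Or.inl (Or.inr h.1)))
      · exact Or.inr (Or.inl (Or.inr h.1))
  · convert! hψa.cylInner using 1
    ext1 z
    change cylMk (ψ (Fin.init (α := fun _ => ℝ) (swapLast (Fin.snoc (α := fun _ => ℝ) z 1))))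
      (clamp (swapLast (Fin.snoc (α := fun _ => ℝ) z 1) (Fin.last (m + 1)))) = _
    rw [init_swapLast, swapLast_last, Fin.init_snoc, Fin.snoc_last, Fin.snoc_castSucc]
  · change cylMk (ψ (Fin.init (α := fun _ => ℝ) (swapLast y)))
      (clamp (swapLast y (Fin.last (m + 1)))) ∈ _ at h'
    rw [mem_openCell_cylInner, cylFst_cylMk, cylSnd_cylMk] at h'
    have hys : swapLast y ∈ sphere (0 : Fin (m + 2) → ℝ) 1 := by
      rw [mem_sphere_zero_iff_norm, norm_swapLast]
      simpa using hy
    obtain ⟨⟨-, h1⟩, h2⟩ := mem_sphere_iff_init_last.1 hys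
    rcases h2 with h2 | h2
    · refine hm _ h2 ?_ h'.1
      rwa [init_swapLast, Fin.snoc_last]
    · rw [coe_clamp h1, h2] at h'
      exact lt_irrefl _ h'.2

end Cylinder

/-! ### Filtrations by single cells -/

section Filtration

variable {K : FiniteCW.{u}}

/-- A cell of maximal dimension among those of `S` outside the subcomplex `A` can be removed
from `S`. -/
lemma exists_remove_cell {A S : K.Sub} (hAS : (A : Set K.X) ⊆ S) (hne : S ≠ A) :
    ∃ (S' : K.Sub) (n : ℕ) (i : K.Cell n), (A : Set K.X) ⊆ S' ∧
      (S : Set K.X) = (S' : Set K.X) ∪ K.openCell n i ∧ i ∉ S'.I n := by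
  have hfin := RelCWComplex.finite_cells_of_finite (C := (univ : Set K.X))
  have hex : ({p : Σ n, K.Cell n | p.2 ∈ S.I p.1 ∧ p.2 ∉ A.I p.1}).Nonempty := by
    by_contra h
    refine hne (Sub.coe_injective (hAS.antisymm' fun x hx => ?_))
    obtain ⟨n, i, hi⟩ := exists_mem_openCell x
    by_contra hxA
    exact h ⟨⟨n, i⟩, Sub.mem_I_iff.2 (Sub.openCell_subset_of_mem hi hx),
      Sub.notMem_I_of_notMem hi hxA⟩
  obtain ⟨⟨n, i⟩, ⟨hiS, hiA⟩, hmax⟩ :=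
    exists_max_image _ (fun p : Σ n, K.Cell n => p.1) (toFinite _) hex
  let S' : K.Sub := CWComplex.Subcomplex.mk' univ ((S : Set K.X) \ K.openCell n i)
    (fun m => {j | j ∈ S.I m ∧ (⟨m, j⟩ : Σ n, K.Cell n) ≠ ⟨n, i⟩})
    (fun m j => by
      have hjS := RelCWComplex.Subcomplex.closedCell_subset_of_mem S j.2.1
      refine fun x hx => ⟨hjS hx, fun hxi => ?_⟩
      by_cases hjA : j.1 ∈ A.I m
      · exact notMem_of_mem_openCell hiA hxi
          (RelCWComplex.Subcomplex.closedCell_subset_of_mem A hjA hx)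
      · rw [← RelCWComplex.cellFrontier_union_openCell_eq_closedCell] at hx
        rcases hx with hx | hx
        -- the frontier lies in dimensions below `m ≤ n`, so it does not meet the `n`-cell `i`
        · have h1 := RelCWComplex.cellFrontier_subset_skeletonLT (C := (univ : Set K.X)) m j.1 hx
          have h2 : m ≤ n := hmax ⟨m, j.1⟩ ⟨j.2.1, hjA⟩
          exact absurd ((mem_skeletonLT_iff_lt hxi).1 h1) (by omega)
        · exact j.2.2 (cell_eq_of_mem hx hxi))
    (by
      ext x
      simp only [mem_iUnion]
      constructor
      · rintro ⟨m, j, hj⟩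
        exact ⟨Sub.mem_I_iff.1 j.2.1 hj, fun hxi => j.2.2 (cell_eq_of_mem hj hxi)⟩
      · rintro ⟨hxS, hxi⟩
        obtain ⟨m, j, hj⟩ := exists_mem_openCell x
        refine ⟨m, ⟨j, Sub.mem_I_iff.2 (Sub.openCell_subset_of_mem hj hxS), fun h => hxi ?_⟩, hj⟩
        obtain ⟨rfl, h⟩ := Sigma.mk.inj_iff.1 h
        exact eq_of_heq h ▸ hj)
  refine ⟨S', n, i, fun x hx => ⟨hAS hx, fun hxi => notMem_of_mem_openCell hiA hxi hx⟩,
    (sdiff_union_of_subset (Sub.mem_I_iff.1 hiS)).symm, ?_⟩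
  obtain ⟨x, hx⟩ := RelCWComplex.openCell_nonempty (C := (univ : Set K.X)) n i
  exact Sub.notMem_I_of_notMem hx fun h => h.2 hx

/-- Every subcomplex that contains `A` arises from `A` by adding one cell at a time. -/
lemma sub_induction {A : K.Sub} {motive : K.Sub → Prop} (base : motive A)
    (step : ∀ (S S' : K.Sub) (n : ℕ) (i : K.Cell n), (A : Set K.X) ⊆ S' →
      (S : Set K.X) = (S' : Set K.X) ∪ K.openCell n i → i ∉ S'.I n → motive S' → motive S)
    (S : K.Sub) (hAS : (A : Set K.X) ⊆ S) : motive S := by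
  have hfin := RelCWComplex.finite_cells_of_finite (C := (univ : Set K.X))
  induction hk : ({p : Σ n, K.Cell n | p.2 ∈ S.I p.1}).ncard using Nat.strong_induction_on
    generalizing S with
  | _ k ih =>
    by_cases hne : S = A
    · exact hne ▸ base
    · obtain ⟨S', n, i, hA, hS, hi⟩ := exists_remove_cell hAS hne
      refine step S S' n i hA hS hi (ih _ ?_ S' hA rfl)
      rw [← hk]
      refine ncard_lt_ncard ⟨fun p hp => ?_, fun h => hi (h (?_ : (⟨n, i⟩ : Σ n, K.Cell n) ∈ _))⟩
        (toFinite _)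
      · refine Sub.mem_I_iff.2 ?_
        rw [hS]
        exact (Sub.mem_I_iff.1 hp).trans subset_union_left
      · refine Sub.mem_I_iff.2 ?_
        rw [hS]
        exact subset_union_right

/-- The empty subcomplex. -/
def emptySub (K : FiniteCW.{u}) : K.Sub :=
  Sub.ofCellular ∅ isClosed_empty fun _ _ _ _ h => h.elim

lemma ElemCollapse.subset {E F : K.Sub} (h : ElemCollapse E F) : (F : Set K.X) ⊆ E := by
  obtain ⟨m, a, b, -, -, hE, -⟩ := h
  rw [hE]
  exact subset_union_left.trans subset_union_left

lemma Collapses.subset {E F : K.Sub} (h : Collapses E F) : (F : Set K.X) ⊆ E := by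
  induction h with
  | refl => exact Subset.rfl
  | tail _ h ih => exact h.subset.trans ih

/-- A map of the `0`-dimensional cube to a `0`-cell is a characteristic map. -/
lemma isCharMap_of_mem {a : K.Cell 0} {ψ : (Fin 0 → ℝ) → K.X} (h : ∀ y, ψ y ∈ K.openCell 0 a) :
    K.IsCharMap 0 a ψ where
  continuousOn := continuous_of_const (fun x y => by rw [Subsingleton.elim x y]) |>.continuousOn
  isEmbedding := .of_subsingleton _
  image_ball := by
    have h0 := h 0
    rw [openCell, RelCWComplex.openCell_zero_eq_singleton] at h0 ⊢
    ext x
    constructor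
    · rintro ⟨y, -, rfl⟩
      rw [Subsingleton.elim y 0]
      exact h0
    · rintro rfl
      exact ⟨0, mem_ball_self one_pos, h0⟩
  mapsTo_sphere := fun y hy => by
    rw [mem_sphere, Subsingleton.elim y 0] at hy
    simp at hy

/-- If a cell of dimension `n` is a single point, then `n = 0`. -/
lemma eq_zero_of_openCell_subset_singleton {n : ℕ} {i : K.Cell n} {x : K.X}
    (h : K.openCell n i ⊆ {x}) : n = 0 := by
  by_contra hn
  have h1 : (fun _ => 1 / 2 : Fin n → ℝ) ∈ ball (0 : Fin n → ℝ) 1 := by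
    rw [mem_ball_zero_iff, pi_norm_lt_iff one_pos]
    intro j
    norm_num
  have h0 : (0 : Fin n → ℝ) ∈ ball (0 : Fin n → ℝ) 1 := mem_ball_self one_pos
  have h01 := (isEmbedding_map n i).injective (a₁ := ⟨_, h0⟩) (a₂ := ⟨_, h1⟩)
    ((h ⟨_, h0, rfl⟩ : _ = x).trans (h ⟨_, h1, rfl⟩ : _ = x).symm)
  have h2 := congrFun (congrArg Subtype.val h01) ⟨0, Nat.pos_of_ne_zero hn⟩
  norm_num at h2

end Filtration

/-! ### The reduced mapping cylinder -/

section ReducedCylinder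

variable {K : FiniteCW.{u}}

/-- The subcomplex `L × {1}` of the cylinder. -/
noncomputable def lid (L : K.Sub) : K.cyl.Sub :=
  Sub.ofCellular {p | cylFst p ∈ (L : Set K.X) ∧ cylSnd p = endpt true}
    (((sub_closed L).preimage continuous_cylFst).inter
      (isClosed_singleton.preimage continuous_cylSnd))
    (cyl_cell_cases
      (fun n i δ p hp hpA q hq => by
        rw [mem_openCell_cylEnd] at hp hq
        exact ⟨Sub.openCell_subset_of_mem hp.1 hpA.1 hq.1, hq.2.trans (hp.2.symm.trans hpA.2)⟩)
      (fun n i p hp hpA => by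
        have h := (mem_openCell_cylInner.1 hp).2
        rw [hpA.2, abs_endpt] at h
        exact absurd h (lt_irrefl _)))

lemma mem_lid {L : K.Sub} {p : K.cyl.X} :
    p ∈ (lid L : Set K.cyl.X) ↔ cylFst p ∈ (L : Set K.X) ∧ cylSnd p = endpt true := Iff.rfl

lemma cylEnd_false_notMem_lid (L : K.Sub) {n : ℕ} (i : K.Cell n) :
    cylEnd i false ∉ (lid L).I n := by
  obtain ⟨x, hx⟩ := RelCWComplex.openCell_nonempty (C := (univ : Set K.X)) n i
  exact Sub.notMem_I_of_notMem (x := cylMk x (endpt false)) (mem_openCell_cylEnd.2 ⟨hx, rfl⟩)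
    fun h => endpt_false_ne_true h.2

lemma cylEnd_true_notMem_lid {L : K.Sub} {n : ℕ} {i : K.Cell n} (hi : i ∉ L.I n) :
    cylEnd i true ∉ (lid L).I n := by
  obtain ⟨x, hx⟩ := RelCWComplex.openCell_nonempty (C := (univ : Set K.X)) n i
  exact Sub.notMem_I_of_notMem (x := cylMk x (endpt true)) (mem_openCell_cylEnd.2 ⟨hx, rfl⟩)
    fun h => notMem_of_mem_openCell hi hx h.1

lemma cylInner_notMem_lid (L : K.Sub) {n : ℕ} (i : K.Cell n) :
    cylInner i ∉ (lid L).I (n + 1) := by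
  intro h
  refine cylInner_notMem_slab (ε := true) (A := K.emptySub) (S := K.emptySub)
    (fun h' => ?_ : i ∉ K.emptySub.I n) (Sub.mem_I_iff.2 ?_)
  · obtain ⟨x, hx⟩ := RelCWComplex.openCell_nonempty (C := (univ : Set K.X)) n i
    exact (Sub.mem_I_iff.1 h' hx : x ∈ (∅ : Set K.X))
  · exact (Sub.mem_I_iff.1 h).trans fun p hp => Or.inl (mem_lid.1 hp).2

lemma lid_subset_slab_true (L A S : K.Sub) : (lid L : Set K.cyl.X) ⊆ slab true A S :=
  fun _ hp => Or.inl hp.2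

lemma lid_subset_slab_false (L S : K.Sub) : (lid L : Set K.cyl.X) ⊆ slab false L S :=
  fun _ hp => Or.inr (Or.inr hp)

lemma quot_slab_whole (L : K.Sub) (ε : Bool) (A : K.Sub) :
    Sub.quot (lid L) (slab ε A K.whole) = (K.cyl.quotient (lid L)).whole := by
  refine Sub.coe_injective (eq_univ_of_forall fun q => ?_)
  obtain ⟨p, rfl⟩ := surjective_quotProj (L := lid L) q
  exact mem_image_of_mem _ (Or.inr (Or.inl (mem_univ _)))

/-- The cells outside `A` can be removed one by one from `K × {ε} ∪ K × [-1, 1] ∪ B × {-ε}`. -/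
lemma collapses_quot_slab (L : K.Sub) (ε : Bool) {A B : K.Sub} (hBA : (B : Set K.X) ⊆ A)
    (hL : ∀ S, (lid L : Set K.cyl.X) ⊆ slab ε B S) :
    Collapses (Sub.quot (lid L) (slab ε B K.whole)) (Sub.quot (lid L) (slab ε B A)) := by
  refine sub_induction (A := A)
    (motive := fun S => Collapses (Sub.quot (lid L) (slab ε B S)) (Sub.quot (lid L) (slab ε B A)))
    .refl (fun S S' n i hA hS hi ih => .head ?_ ih) K.whole (subset_univ _)
  refine (elemCollapse_slab_of_cell ε hS hi fun hiB => hi ?_).quot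
    (inter_subset_right.trans (hL S'))
  exact Sub.mem_I_iff.2 ((Sub.mem_I_iff.1 hiB).trans (hBA.trans hA))

/-- A collapse of `L` to `P` gives a collapse of the cone on `L`, with the base `K` attached, to
the cone on `P`. -/
lemma collapses_quot_slab_of_collapses {L S P : K.Sub} (h : Collapses S P)
    (hS : (S : Set K.X) ⊆ L) :
    Collapses (Sub.quot (lid L) (slab false L S)) (Sub.quot (lid L) (slab false L P)) := by
  induction h using Relation.ReflTransGen.head_induction_on with
  | refl => exact .refl
  | head h _ ih =>
    exact .head ((elemCollapse_slab_of_elemCollapse false h hS).quot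
      (inter_subset_right.trans (lid_subset_slab_false L _))) (ih (h.subset.trans hS))

/-- The segment over a point, together with the cone point, collapses to the base. -/
lemma elemCollapse_quot_slab_point {L P : K.Sub} {x₀ : K.X} (hP : (P : Set K.X) = {x₀})
    (hPL : (P : Set K.X) ⊆ L) :
    ElemCollapse (Sub.quot (lid L) (slab false L P))
      (Sub.quot (lid L) (slab false K.emptySub K.emptySub)) := by
  have hx₀ : x₀ ∈ (P : Set K.X) := hP ▸ mem_singleton x₀
  obtain ⟨n, i, hi⟩ := exists_mem_openCell x₀
  have hiP : K.openCell n i = {x₀} :=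
    (hP ▸ Sub.openCell_subset_of_mem hi hx₀).antisymm (singleton_subset_iff.2 hi)
  obtain rfl := eq_zero_of_openCell_subset_singleton hiP.subset
  have hlid : cylMk x₀ (endpt true) ∈ (lid L : Set K.cyl.X) := ⟨hPL hx₀, rfl⟩
  have hne : (lid L : Set K.cyl.X).Nonempty := ⟨_, hlid⟩
  have hopen := openCell_quotPoint hne hlid
  -- the points over the image of the base lie at the end `-1`, those over the cone point at `1`
  have hbase : ∀ p : K.cyl.X, quotProj (lid L) p ∈
      (Sub.quot (lid L) (slab false K.emptySub K.emptySub) : Set (K.cyl.quotient (lid L)).X) →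
      cylSnd p = endpt false := by
    rintro p ⟨q, hq, hqp⟩
    have hq' : cylSnd q = endpt false := by
      rcases hq with h | h | h
      · exact h
      · exact h.elim
      · exact h.1.elim
    rcases quotProj_eq_iff.1 hqp with rfl | h
    · exact hq'
    · exact absurd (hq'.symm.trans h.1.2) endpt_false_ne_true
  have hinner := (isCharMap_map 0 i).cylInner.quotProj_comp (cylInner_notMem_lid L i)
  have hcone : ∀ p : K.cyl.X, quotProj (lid L) p = quotProj (lid L) (cylMk x₀ (endpt true)) →
      cylSnd p = endpt true := by
    intro p h
    rcases quotProj_eq_iff.1 h with rfl | h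
    · rfl
    · exact h.1.2
  refine elemCollapse_iff.2 ⟨0, quotPoint hne, quotCell (cylInner i) (cylInner_notMem_lid L i),
    ?_, ?_, ?_, _, hinner, isCharMap_of_mem fun y => ?_, fun y hy hlast h => ?_⟩
  · refine Sub.notMem_I_of_notMem (hopen ▸ mem_singleton _) fun h => ?_
    exact endpt_false_ne_true (hbase _ h).symm
  · have h0 : |((⟨0, by norm_num⟩ : Icc (-1 : ℝ) 1) : ℝ)| < 1 := by simp
    refine Sub.notMem_I_of_notMem (x := quotProj (lid L) (cylMk x₀ ⟨0, by norm_num⟩)) ?_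
      fun h => ?_
    · rw [openCell_quotCell]
      exact mem_image_of_mem _ (mem_openCell_cylInner.2 ⟨hi, h0⟩)
    · have h' := hbase _ h
      rw [cylSnd_cylMk] at h'
      rw [h', abs_endpt] at h0
      exact lt_irrefl _ h0
  · rw [hopen, openCell_quotCell]
    apply subset_antisymm
    · rintro _ ⟨p, hp, rfl⟩
      rcases hp with h | h | h
      · exact Or.inl (Or.inl (mem_image_of_mem _ (Or.inl h)))
      · have hpx : cylFst p = x₀ := by rwa [hP] at h
        rcases abs_lt_one_or_eq_endpt (cylSnd p) with h' | ⟨_ | _, h'⟩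
        · exact Or.inr (mem_image_of_mem _ (mem_openCell_cylInner.2 ⟨hpx ▸ hi, h'⟩))
        · exact Or.inl (Or.inl (mem_image_of_mem _ (Or.inl h')))
        · exact Or.inl (Or.inr (quotProj_eq ⟨hPL h, h'⟩ hlid))
      · exact Or.inl (Or.inr (quotProj_eq h hlid))
    · refine union_subset (union_subset (image_mono fun p hp => ?_) ?_)
        (image_mono fun p hp => ?_)
      · rcases hp with h | h | h
        · exact Or.inl h
        · exact h.elim
        · exact h.1.elim
      · exact singleton_subset_iff.2 (mem_image_of_mem _ (Or.inr (Or.inl hx₀)))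
      · have h := (mem_openCell_cylInner.1 hp).1
        rw [hiP, ← hP] at h
        exact Or.inr (Or.inl h)
  · rw [hopen]
    have hmem : RelCWComplex.map (C := (univ : Set K.X)) 0 i y ∈ (P : Set K.X) := by
      rw [hP, ← hiP]
      exact (isCharMap_map 0 i).mem_openCell (by simp [Subsingleton.elim y 0])
    refine quotProj_eq ⟨hPL (?_ : cylFst (cylMk _ _) ∈ _), ?_⟩ hlid
    · rwa [cylFst_cylMk, Fin.init_snoc]
    · rw [cylSnd_cylMk, Fin.snoc_last]
      exact clamp_one false
  · rw [hopen] at h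
    exact clamp_ne_endpt_not (ε := false) (mem_sphere_iff_init_last.1 hy).1.2 hlast (hcone _ h)

/-- The bottom of the reduced mapping cylinder is a copy of `K`. -/
lemma isoSub_bottom (L : K.Sub) :
    K.IsoSub (Sub.quot (lid L) (slab false K.emptySub K.emptySub)) := by
  refine ⟨fun x => quotProj (lid L) (cylMk x (endpt false)), ?_, ?_, fun n i =>
    ⟨quotCell (cylEnd i false) (cylEnd_false_notMem_lid L i), ?_⟩⟩
  · refine ((continuous_quotProj.comp (continuous_cylMk_left _)).isClosedEmbedding
      fun x y h => ?_).isEmbedding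
    rcases quotProj_eq_iff.1 h with h | h
    · exact congrArg cylFst h
    · exact absurd h.1.2 endpt_false_ne_true
  · rw [Sub.coe_quot]
    ext q
    constructor
    · rintro ⟨x, rfl⟩
      exact mem_image_of_mem _ (Or.inl rfl)
    · rintro ⟨p, hp, rfl⟩
      rcases hp with h | h | h
      · refine ⟨cylFst p, ?_⟩
        beta_reduce
        rw [← h, cylMk_eta]
      · exact h.elim
      · exact h.1.elim
  · rw [openCell_quotCell]
    apply subset_antisymm
    · rintro _ ⟨x, hx, rfl⟩
      exact mem_image_of_mem _ (mem_openCell_cylEnd.2 ⟨hx, rfl⟩)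
    · rintro _ ⟨p, hp, rfl⟩
      rw [mem_openCell_cylEnd] at hp
      refine ⟨cylFst p, hp.1, ?_⟩
      beta_reduce
      rw [← hp.2, cylMk_eta]

/-- The top of the reduced mapping cylinder is a copy of `K/L`. -/
lemma isoSub_top (L : K.Sub) :
    (K.quotient L).IsoSub (Sub.quot (lid L) (slab true K.emptySub K.emptySub)) := by
  let f : (K.quotient L).X → (K.cyl.quotient (lid L)).X := fun q =>
    quotProj (lid L) (cylMk (K.quotOut L q) (endpt true))
  have hf : ∀ x, f (quotProj L x) = quotProj (lid L) (cylMk x (endpt true)) := by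
    intro x
    have h : quotProj L (K.quotOut L (quotProj L x)) = quotProj L x := K.quotMk_out L _
    rcases quotProj_eq_iff.1 h with h | h
    · change quotProj (lid L) (cylMk (K.quotOut L (quotProj L x)) (endpt true)) = _
      rw [h]
    · exact quotProj_eq ⟨h.1, rfl⟩ ⟨h.2, rfl⟩
  have hc : Continuous f := by
    refine (K.isQuotientMap_quotMk L).continuous_iff.2 ?_
    convert! (continuous_quotProj (L := lid L)).comp (continuous_cylMk_left (endpt true)) using 1
    ext1 x
    exact hf x
  have hinj : Function.Injective f := by
    intro q r h
    obtain ⟨x, rfl⟩ := surjective_quotProj q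
    obtain ⟨y, rfl⟩ := surjective_quotProj r
    rw [hf, hf] at h
    rcases quotProj_eq_iff.1 h with h | h
    · rw [show x = y from congrArg cylFst h]
    · exact quotProj_eq h.1.1 h.2.1
  have hlid : ∀ hL : (L : Set K.X).Nonempty,
      cylMk hL.some (endpt true) ∈ (lid L : Set K.cyl.X) := fun hL => ⟨hL.some_mem, rfl⟩
  have hne : (L : Set K.X).Nonempty → (lid L : Set K.cyl.X).Nonempty := fun hL => ⟨_, hlid hL⟩
  refine ⟨f, (hc.isClosedEmbedding hinj).isEmbedding, ?_, quotient_cell_cases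
    (fun n i hi => ⟨quotCell (cylEnd i true) (cylEnd_true_notMem_lid hi), ?_⟩)
    (fun hL => ⟨quotPoint (hne hL), ?_⟩)⟩
  · rw [Sub.coe_quot]
    ext q
    constructor
    · rintro ⟨r, rfl⟩
      obtain ⟨x, rfl⟩ := surjective_quotProj r
      rw [hf]
      exact mem_image_of_mem _ (Or.inl rfl)
    · rintro ⟨p, hp, rfl⟩
      rcases hp with h | h | h
      · exact ⟨quotProj L (cylFst p), by rw [hf, ← h, cylMk_eta]⟩
      · exact h.elim
      · exact h.1.elim
  · rw [openCell_quotCell, openCell_quotCell, image_image]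
    apply subset_antisymm
    · rintro _ ⟨x, hx, rfl⟩
      beta_reduce
      rw [hf]
      exact mem_image_of_mem _ (mem_openCell_cylEnd.2 ⟨hx, rfl⟩)
    · rintro _ ⟨p, hp, rfl⟩
      rw [mem_openCell_cylEnd] at hp
      exact ⟨cylFst p, hp.1, by beta_reduce; rw [hf, ← hp.2, cylMk_eta]⟩
  · rw [openCell_quotPoint hL hL.some_mem, image_singleton, hf, openCell_quotPoint (hne hL) (hlid hL)]

end ReducedCylinder

/-- `K` expands to the reduced mapping cylinder of `K → K/L`, which collapses to `K/L`. -/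
theorem deforms_quotient {n : ℕ} {K : FiniteCW.{u}} (hK : K.DimLE n) {L : K.Sub}
    (hL : CollapsesToPoint L) : Deforms (n + 1) K (K.quotient L) := by
  obtain ⟨P, x₀, hP, hLP⟩ := hL
  have hM : (K.cyl.quotient (lid L)).DimLE (n + 1) := hK.cyl.quotient _
  have h_bottom : Relation.TransGen ElemCollapse (K.cyl.quotient (lid L)).whole
      (Sub.quot (lid L) (slab false K.emptySub K.emptySub)) := by
    rw [← quot_slab_whole L false L]
    exact .tail' ((collapses_quot_slab L false Subset.rfl (lid_subset_slab_false L)).trans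
      (collapses_quot_slab_of_collapses hLP Subset.rfl))
      (elemCollapse_quot_slab_point hP hLP.subset)
  have h_top : Relation.TransGen ElemCollapse (K.cyl.quotient (lid L)).whole
      (Sub.quot (lid L) (slab true K.emptySub K.emptySub)) := by
    have h := collapses_quot_slab L true (A := K.emptySub) Subset.rfl
      (lid_subset_slab_true L K.emptySub)
    rw [quot_slab_whole L true K.emptySub] at h
    refine (Relation.reflTransGen_iff_eq_or_transGen.1 h).resolve_left fun h' => ?_
    -- the two differ: the point `(x₀, -1)` is not in the top
    have hx : quotProj (lid L) (cylMk x₀ (endpt false)) ∈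
        (Sub.quot (lid L) (slab true K.emptySub K.emptySub) :
          Set (K.cyl.quotient (lid L)).X) := by
      rw [h']
      exact mem_univ _
    have hx' : cylMk x₀ (endpt false) ∉ (lid L : Set K.cyl.X) :=
      fun h => endpt_false_ne_true h.2
    rw [Sub.coe_quot, quotProj_mem_image_iff hx'] at hx
    rcases hx with h | h | h
    · exact endpt_false_ne_true h
    · exact h.elim
    · exact h.1.elim
  have hW := Sub.isoSub_toCW (K.cyl.quotient (lid L)).whole
  exact deforms_of_reflTransGen
    ((Std.Symm.symm _ _ (reflTransGen_deformStep hM h_bottom hW (isoSub_bottom L))).trans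
      (reflTransGen_deformStep hM h_top hW (isoSub_top L)))
    (hM.of_isoSub (isoSub_top L))

end FiniteCW

theorem mainTheorem12 (n : ℕ) (K : FiniteCW.{u}) (hK : K.DimLE n) (L : K.Sub)
    (hL : FiniteCW.CollapsesToPoint L) :
    FiniteCW.Deforms (n + 1) K (K.quotient L) := by
  exact FiniteCW.deforms_quotient hK hL
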